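/- Throughout, $\log x$ stands for $\max\{1,\log_2 x\}$ (also when iterated). Consider finite directed graphs $G=(V,E)$ in which two nodes joined by an edge (in either direction) can exchange messages in both directions in synchronous rounds; internal computation is free, nodes have unique identifiers, and a node terminates when it outputs its color. For a node $v$ let $\beta_v$ be the maximum of $1$ and the outdegree of $v$, and let $\beta=\max_{v}\beta_v$. In an oriented list defective coloring instance with a finite color space $\mathcal{C}\subset\mathbb{N}$, every node $v$ is given a list $L_v\subseteq\mathcal{C}$ and a defect function $d_v:L_v\to\mathbb{N}_0$; a solution assigns to every node $v$ a color $\varphi(v)\in L_v$ such that at most $d_v(\varphi(v))$ outneighbors of $v$ have color $\varphi(v)$. Let $\Lambda=\max_v|L_v|$. **Theorem 1.** There is a constant $\alpha>0$ such that the following holds. Let $G=(V,E)$ be a directed graph that is given with a proper coloring with $m$ colors, and let an oriented list defective coloring instance on $G$ be given such that for every node $v\in V$ $$\sum_{x\in L_v}\big(d_v(x)+1\big)^2\ \ge\ \alpha\cdot\beta_v^2\cdot\kappa(\beta,\mathcal{C},m),$$ where $$\kappa(\beta,\mathcal{C},m)=\big(\log\beta+\log\log|\mathcal{C}|+\log\log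 m\big)\cdot\big(\log\log\beta+\log\log m\big)\cdot(\log\log\beta)^2 .$$ Then a deterministic distributed algorithm, which depends only on $\beta$, $\mathcal{C}$ and $m$, solves this instance in $O(\log\beta)$ rounds using messages of $O\big(\min\{|\mathcal{C}|,\Lambda\cdot\log|\mathcal{C}|\}+\log\beta+\log m\big)$ bits. The constants in the $O$-notation are absolute. -/

import Mathlib

namespace OLDC

/-- Base-2 logarithm with the usual asymptotic convention that a logarithm is at least `1`
(so that iterated logarithms of small numbers make sense and do not vanish). -/
noncomputable def lg (x : ℝ) : ℝ := max 1 (Real.logb 2 x)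

/-- `κ(β, 𝒞, m) = (log β + log log |𝒞| + log log m) (log log β + log log m) (log log β)²`,
as a function of `β`, `c = |𝒞|` and `m`. -/
noncomputable def kappa (β c m : ℕ) : ℝ :=
  (lg β + lg (lg c) + lg (lg m)) * (lg (lg β) + lg (lg m)) * lg (lg β) ^ 2

section Graph

variable {V : Type*} [Fintype V]

open Classical in
/-- The outneighbors of `v`. -/
noncomputable def outNbrs (G : Digraph V) (v : V) : Finset V :=
  Finset.univ.filter fun u => G.Adj v u

open Classical in
/-- The neighbors of `v` in the communication graph; communication is possible in both
directions of every directed edge. -/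
noncomputable def nbrs (G : Digraph V) (v : V) : Finset V :=
  Finset.univ.filter fun u => G.Adj v u ∨ G.Adj u v

theorem mem_nbrs_comm (G : Digraph V) {u v : V} (h : u ∈ nbrs G v) : v ∈ nbrs G u := by
  simp only [nbrs, Finset.mem_filter, Finset.mem_univ, true_and] at h ⊢
  exact h.symm

/-- `β_v`: the maximum of `1` and the outdegree of `v`. -/
noncomputable def outDeg (G : Digraph V) (v : V) : ℕ := max 1 (outNbrs G v).card

/-- `β`: the maximum of `β_v` over all nodes `v`. -/
noncomputable def maxOutDeg (G : Digraph V) : ℕ := Finset.univ.sup (outDeg G)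

/-- `φ` is an oriented list defective coloring for the lists `L` and the defect functions `d`:
every node `v` has a color from its list and at most `d v (φ v)` outneighbors of color `φ v`.
(Only the values of `d v` on `L v` matter.) -/
def IsOrientedListDefectiveColoring (G : Digraph V) (L : V → Finset ℕ) (d : V → ℕ → ℕ)
    (φ : V → ℕ) : Prop :=
  ∀ v, φ v ∈ L v ∧ ((outNbrs G v).filter fun u => φ u = φ v).card ≤ d v (φ v)

end Graph

/-- A network together with an input: a directed graph with a proper `m`-coloring, lists of
colors from the color space `C`, defect functions, unique identifiers, and, for every node, an
arbitrary numbering of its neighbors by ports. -/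
structure Network (V : Type*) [Fintype V] (C : Finset ℕ) (m : ℕ) where
  /-- the directed graph -/
  graph : Digraph V
  /-- the initial coloring with `m` colors -/
  color : V → Fin m
  /-- the initial coloring is proper -/
  color_proper : ∀ u v, graph.Adj u v → color u ≠ color v
  /-- the color list `L_v` of every node -/
  list : V → Finset ℕ
  /-- the lists consist of colors of the color space -/
  list_subset : ∀ v, list v ⊆ C
  /-- the defect function `d_v` of every node -/
  defect : V → ℕ → ℕ
  /-- the identifier of every node -/
  ident : V → ℕ
  /-- identifiers are unique -/
  ident_injective : Function.Injective ident
  /-- the neighbor behind each port of a node -/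
  port : ∀ v, Fin (nbrs graph v).card ≃ {u // u ∈ nbrs graph v}

/-- What a node knows when the algorithm starts (apart from global parameters). -/
structure NodeInput where
  /-- its identifier -/
  ident : ℕ
  /-- its color in the initial proper coloring -/
  color : ℕ
  /-- its color list -/
  list : Finset ℕ
  /-- its defect function -/
  defect : ℕ → ℕ
  /-- its number of neighbors -/
  numPorts : ℕ
  /-- the ports that lead to outneighbors -/
  isOut : Fin numPorts → Prop
  /-- the ports that lead to inneighbors -/
  isIn : Fin numPorts → Prop

/-- A deterministic distributed (synchronous message passing) algorithm. Messages are bit strings;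
the empty string stands for not sending anything. Internal computation is unrestricted. A node
terminates as soon as `output` gives a color. -/
structure Algorithm where
  /-- the internal states of a node -/
  State : Type
  /-- the state at time `0` -/
  init : NodeInput → State
  /-- the message that is sent through each port -/
  send : State → ℕ → List Bool
  /-- the new state, given the messages that were received through the ports -/
  receive : State → (ℕ → List Bool) → State
  /-- the output of the node, if the node has terminated -/
  output : State → Option ℕ

namespace Network

variable {V : Type*} [Fintype V] {C : Finset ℕ} {m : ℕ}

/-- The maximum list size `Λ`. -/
def maxListSize (N : Network V C m) : ℕ := Finset.univ.sup fun v => (N.list v).card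

/-- The initial knowledge of node `v`. -/
noncomputable def input (N : Network V C m) (v : V) : NodeInput where
  ident := N.ident v
  color := N.color v
  list := N.list v
  defect := N.defect v
  numPorts := (nbrs N.graph v).card
  isOut p := N.graph.Adj v (N.port v p)
  isIn p := N.graph.Adj (N.port v p) v

/-- If port `p` of `v` leads to `u`, the port of `u` that leads to `v`. -/
noncomputable def backPort (N : Network V C m) (v : V) (p : Fin (nbrs N.graph v).card) :
    Fin (nbrs N.graph (N.port v p)).card :=
  (N.port (N.port v p)).symm ⟨v, mem_nbrs_comm N.graph (N.port v p).2⟩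

end Network

namespace Algorithm

variable {V : Type*} [Fintype V] {C : Finset ℕ} {m : ℕ}

/-- The message that a node in state `s` sends through port `p`; terminated nodes are silent. -/
def outgoing (A : Algorithm) (s : A.State) (p : ℕ) : List Bool :=
  if (A.output s).isSome then [] else A.send s p

/-- The messages that arrive at the ports of `v` in a round in which `σ` gives the current
states of all nodes. -/
noncomputable def inbox (A : Algorithm) (N : Network V C m) (σ : V → A.State) (v : V) (p : ℕ) :
    List Bool :=
  if h : p < (nbrs N.graph v).card then
    A.outgoing (σ (N.port v ⟨p, h⟩)) (N.backPort v ⟨p, h⟩)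
  else []

/-- The states of all nodes after `t` rounds; terminated nodes do not change any more. -/
noncomputable def state (A : Algorithm) (N : Network V C m) : ℕ → V → A.State
  | 0 => fun v => A.init (N.input v)
  | t + 1 => fun v =>
      if (A.output (A.state N t v)).isSome then A.state N t v
      else A.receive (A.state N t v) (A.inbox N (A.state N t) v)

/-- After at most `T` rounds all nodes have terminated, and their outputs form an oriented list
defective coloring of the given instance. -/
def SolvesWithin (A : Algorithm) (N : Network V C m) (T : ℕ) : Prop :=
  ∃ φ : V → ℕ, (∀ v, A.output (A.state N T v) = some (φ v)) ∧
    IsOrientedListDefectiveColoring N.graph N.list N.defect φ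

/-- In every round, every message that is sent to a neighbor has at most `B` bits. -/
def UsesMessagesOfSize (A : Algorithm) (N : Network V C m) (B : ℝ) : Prop :=
  ∀ (t : ℕ) (v : V) (p : Fin (nbrs N.graph v).card),
    ((A.outgoing (A.state N t v) p).length : ℝ) ≤ B

end Algorithm

end OLDC

/-!
The algorithm consists of two runs of one and the same subroutine, the *core algorithm* `Core.rule`.

**The core algorithm.** There is a relation `R` on the colors such that every color `y` is related
to at most `D` colors `x`, and every node has a list of colors and a class `c < H`. It selects a
color of its list such that few outneighbors select related colors; `2 ^ c` is roughly the
outdegree divided by the tolerated number of conflicts. Nodes of class `H` only need some color of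
their list. In ascending order of the classes every node first shrinks its list to
`listSize D τ c ≈ D τ 4 ^ c` colors, dropping those that occur too often in the sets of outneighbors
of much smaller class. It then selects a set of `setSize τ c ≈ τ 2 ^ c` colors of the shrunken
list. In descending order of the classes every node finally selects a color of its set, namely one
that minimizes the conflicts with the outneighbors of larger class, which have already selected
theirs, and the overlap with the sets of the outneighbors of similar or smaller class, which have
not.

The sets can be selected without coordination because of `exists_families`: to every triple of
initial color, class and shrunken list belongs a fixed family of `8 * 2 ^ H * q` candidate sets, and
for any two triples with distinct initial colors only `q` candidate sets of the triple of larger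
class (of either one, if the classes agree) have at least `τ` colors related to some candidate set
of the other one. A node that knows the triples of its outneighbors can therefore choose a candidate
set that is in conflict with only few of the outneighbors of similar class. The families exist by
the probabilistic method: cut every list into blocks and draw one color per block. An exponential
moment bound (`card_many_hits_mul_two_pow_le`) is applied twice, to the colors of one candidate set
and to the candidate sets of one family, and a union bound covers the pairs of triples. It suffices
that `τ` is of the order of `H + log log m + log log |X| + log D`, where `X` is the color space
(`exists_valid_core`). The outcome is `Core.card_related_result_le`.

**The two runs.** A node with `b = β_v` sorts the colors `x` of its list into buckets `j` according
to `2 ^ j ≈ b / (d_v x + 1)`; there are about `log β` of them. Choosing the heaviest bucket would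
cost a factor `log β`. Instead, the buckets are the colors of an auxiliary instance, in which two
buckets are related if they differ by `O(log log β)`. A bucket `j` that has only `τ 4 ^ (j - s)`
colors suffices if at most `b / 2 ^ s` outneighbors choose a bucket close to `j`. The node then runs
the core algorithm in class `j - s` with the colors of that bucket as its list. Only scales
`s = O(log log β)` matter. By pigeonhole (`exists_plan`), the hypothesis on the squared defects
provides a scale `s` for which enough buckets are available to solve the auxiliary instance with the
core algorithm, whose color space has only `O(log β)` elements and whose classes are the scales.
The factors `log log β + log log m` and `(log log β) ^ 2` of `κ` come from this auxiliary run: from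
its threshold `τ`, the number of scales and the width of the window of close buckets.

Messages consist of an initial color, a class and a set of colors. Enumerating the subsets of the
color space by cardinality gives the claimed message size (`exists_encoding`).
-/

namespace OLDC

open Finset

/-! ### Exponential moments and the union bound -/

section Counting

/-- The sum of `8 ^ (number of hits)` over all `ω` factors over the coordinates, and every `ω` with
at least `τ` hits contributes at least `8 ^ τ` to it. -/
theorem card_many_hits_mul_le {ι β : Type*} [Fintype ι] [DecidableEq ι] [Fintype β]
    [DecidableEq β] (B : ι → Finset β) (τ : ℕ) :
    (univ.filter fun ω : ι → β => τ ≤ (univ.filter fun r => ω r ∈ B r).card).card * 8 ^ τ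
      ≤ ∏ r, (Fintype.card β + 7 * (B r).card) := by
  have key : ∏ r, (Fintype.card β + 7 * (B r).card)
      = ∑ ω : ι → β, 8 ^ (univ.filter fun r => ω r ∈ B r).card := by
    have h1 : ∀ r, Fintype.card β + 7 * (B r).card = ∑ x : β, if x ∈ B r then 8 else 1 := by
      intro r
      have : ∀ x : β, (if x ∈ B r then 8 else 1) = 1 + (if x ∈ B r then 7 else 0) := by
        intro x; split_ifs <;> rfl
      simp_rw [this, Finset.sum_add_distrib]
      simp [mul_comm]
    simp_rw [h1]
    rw [Finset.prod_univ_sum]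
    simp only [Fintype.piFinset_univ]
    refine Finset.sum_congr rfl fun ω _ => ?_
    rw [Finset.prod_ite]
    simp
  rw [key, Finset.card_eq_sum_ones, Finset.sum_mul]
  calc _ ≤ ∑ ω ∈ univ.filter (fun ω : ι → β => τ ≤ (univ.filter fun r => ω r ∈ B r).card),
        8 ^ (univ.filter fun r => ω r ∈ B r).card := by
        refine Finset.sum_le_sum fun ω hω => ?_
        rw [one_mul]
        exact Nat.pow_le_pow_right (by norm_num) (Finset.mem_filter.1 hω).2
    _ ≤ _ := Finset.sum_le_sum_of_subset (Finset.filter_subset _ _)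

/-- If the expected number of hits is at most `τ / 8`, a fraction of at most `2 ^ (-τ)` of all `ω` has
`τ` hits or more. -/
theorem card_many_hits_mul_two_pow_le {ι β : Type*} [Fintype ι] [DecidableEq ι] [Fintype β]
    [DecidableEq β] [Nonempty β] (B : ι → Finset β) (τ : ℕ)
    (hB : 8 * ∑ r, (B r).card ≤ τ * Fintype.card β) :
    (univ.filter fun ω : ι → β => τ ≤ (univ.filter fun r => ω r ∈ B r).card).card * 2 ^ τ
      ≤ Fintype.card (ι → β) := by
  set N := (univ.filter fun ω : ι → β => τ ≤ (univ.filter fun r => ω r ∈ B r).card).card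
  have h1 := card_many_hits_mul_le B τ
  have hb : (0 : ℝ) < Fintype.card β := by exact_mod_cast Fintype.card_pos
  have h2 : ((∏ r, (Fintype.card β + 7 * (B r).card) : ℕ) : ℝ)
      ≤ (Fintype.card β : ℝ) ^ Fintype.card ι * 4 ^ τ := by
    push_cast
    calc ∏ r, ((Fintype.card β : ℝ) + 7 * (B r).card)
        ≤ ∏ r, ((Fintype.card β : ℝ) * Real.exp (7 * (B r).card / Fintype.card β)) := by
          refine Finset.prod_le_prod (fun r _ => by positivity) fun r _ => ?_
          have := Real.add_one_le_exp (7 * ((B r).card : ℝ) / Fintype.card β)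
          calc (Fintype.card β : ℝ) + 7 * (B r).card
              = Fintype.card β * (7 * ((B r).card : ℝ) / Fintype.card β + 1) := by
                field_simp
                ring
            _ ≤ _ := by gcongr
      _ = (Fintype.card β : ℝ) ^ Fintype.card ι *
            Real.exp (7 * (∑ r, ((B r).card : ℝ)) / Fintype.card β) := by
          rw [Finset.prod_mul_distrib, ← Real.exp_sum, Finset.mul_sum, Finset.sum_div]
          simp
      _ ≤ (Fintype.card β : ℝ) ^ Fintype.card ι * 4 ^ τ := by
          gcongr
          have h3 : 8 * (∑ r, ((B r).card : ℝ)) ≤ τ * Fintype.card β := by exact_mod_cast hB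
          have h4 : 7 * (∑ r, ((B r).card : ℝ)) / Fintype.card β ≤ τ := by
            rw [div_le_iff₀ hb]
            have : 0 ≤ ∑ r, ((B r).card : ℝ) := Finset.sum_nonneg fun _ _ => by positivity
            linarith
          calc Real.exp (7 * (∑ r, ((B r).card : ℝ)) / Fintype.card β) ≤ Real.exp τ :=
                Real.exp_le_exp.2 h4
            _ = Real.exp 1 ^ τ := by rw [← Real.exp_nat_mul, mul_one]
            _ ≤ 4 ^ τ := by
                gcongr
                linarith [Real.exp_one_lt_d9]
  have h3 : (N : ℝ) * 8 ^ τ ≤ (Fintype.card β : ℝ) ^ Fintype.card ι * 4 ^ τ :=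
    le_trans (by exact_mod_cast h1) h2
  have h4 : (N : ℝ) * 2 ^ τ ≤ (Fintype.card β : ℝ) ^ Fintype.card ι := by
    have : (8 : ℝ) ^ τ = 2 ^ τ * 4 ^ τ := by rw [← mul_pow]; norm_num
    rw [this, ← mul_assoc] at h3
    exact le_of_mul_le_mul_right h3 (by positivity)
  rw [Fintype.card_fun]
  exact_mod_cast h4

/-- Union bound for independent choices `ω t`: if each pairwise event has probability at most `1 / N`
conditionally on the choice for `t'`, and there are fewer than `N` pairs, then some `ω` avoids all
these events. -/
theorem exists_forall_not_of_card_mul_le {T : Type*} [Fintype T] [DecidableEq T] (Ω : T → Type*)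
    [∀ t, Fintype (Ω t)] [∀ t, Nonempty (Ω t)] (bad : ∀ t t', Ω t → Ω t' → Prop) (N : ℕ)
    (hN : Fintype.card T ^ 2 < N)
    (hbad : ∀ t t', t ≠ t' → ∀ y : Ω t', Nat.card {x : Ω t // bad t t' x y} * N
      ≤ Fintype.card (Ω t)) :
    ∃ ω : ∀ t, Ω t, ∀ t t', t ≠ t' → ¬ bad t t' (ω t) (ω t') := by
  classical
  by_contra! hcon
  -- Fix all coordinates but `t` and sum the conditional bounds.
  have hpair : ∀ t t', t ≠ t' →
      (univ.filter fun ω : ∀ t, Ω t => bad t t' (ω t) (ω t')).card * N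
        ≤ Fintype.card (∀ t, Ω t) := by
    intro t t' htt
    rw [Fintype.card_congr (Equiv.piSplitAt t Ω), Fintype.card_prod]
    have e1 : (univ.filter fun ω : ∀ t, Ω t => bad t t' (ω t) (ω t')).card
        = (univ.filter fun z : Ω t × (∀ j : {j // j ≠ t}, Ω j) =>
            bad t t' z.1 (z.2 ⟨t', htt.symm⟩)).card := by
      refine Finset.card_equiv (Equiv.piSplitAt t Ω) fun ω => ?_
      simp [Equiv.piSplitAt]
    have e2 : (univ.filter fun z : Ω t × (∀ j : {j // j ≠ t}, Ω j) =>
            bad t t' z.1 (z.2 ⟨t', htt.symm⟩)).card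
        = ∑ w : (∀ j : {j // j ≠ t}, Ω j),
            Nat.card {x : Ω t // bad t t' x (w ⟨t', htt.symm⟩)} := by
      rw [Finset.card_filter, ← Finset.univ_product_univ, Finset.sum_product_right]
      refine Finset.sum_congr rfl fun w _ => ?_
      rw [Nat.card_eq_fintype_card, Fintype.card_subtype, Finset.card_filter]
    rw [e1, e2, Finset.sum_mul]
    calc _ ≤ ∑ w : (∀ j : {j // j ≠ t}, Ω j), Fintype.card (Ω t) :=
          Finset.sum_le_sum fun w _ => hbad t t' htt _
      _ = _ := by simp [mul_comm]
  have hpos : 0 < Fintype.card (∀ t, Ω t) := Fintype.card_pos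
  have hcover : (univ : Finset (∀ t, Ω t)) ⊆
      ((univ : Finset (T × T)).filter fun q => q.1 ≠ q.2).biUnion
        fun q => univ.filter fun ω : ∀ t, Ω t => bad q.1 q.2 (ω q.1) (ω q.2) := by
    intro ω _
    obtain ⟨t, t', htt, hb⟩ := hcon ω
    simp only [Finset.mem_biUnion, Finset.mem_filter, Finset.mem_univ, true_and]
    exact ⟨(t, t'), htt, hb⟩
  have h1 := (Finset.card_le_card hcover).trans Finset.card_biUnion_le
  have h2 : Fintype.card (∀ t, Ω t) * N ≤ Fintype.card T ^ 2 * Fintype.card (∀ t, Ω t) := by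
    calc Fintype.card (∀ t, Ω t) * N ≤ (∑ q ∈ (univ : Finset (T × T)).filter fun q => q.1 ≠ q.2,
          (univ.filter fun ω : ∀ t, Ω t => bad q.1 q.2 (ω q.1) (ω q.2)).card) * N :=
          Nat.mul_le_mul_right _ h1
      _ ≤ ∑ q ∈ (univ : Finset (T × T)).filter fun q => q.1 ≠ q.2, Fintype.card (∀ t, Ω t) := by
          rw [Finset.sum_mul]
          exact Finset.sum_le_sum fun q hq => hpair _ _ (Finset.mem_filter.1 hq).2
      _ ≤ _ := by
          rw [Finset.sum_const, smul_eq_mul]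
          refine Nat.mul_le_mul_right _ ((Finset.card_le_univ _).trans ?_)
          rw [Fintype.card_prod, sq]
  rw [mul_comm] at h2
  have := Nat.le_of_mul_le_mul_right h2 hpos
  omega

end Counting

/-! ### Families of candidate sets -/

section Families

theorem natCard_mem_and {α : Type*} (A : Finset α) (p : α → Prop) [DecidablePred p] :
    Nat.card {x // x ∈ A ∧ p x} = (A.filter p).card :=
  Nat.subtype_card _ (by simp)

/-- `A` and `B` are in conflict (in this order): at least `τ` elements of `A` are related to an element
of `B`. -/
def Conflict (R : ℕ → ℕ → Prop) (τ : ℕ) (A B : Finset ℕ) : Prop :=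
  τ ≤ Nat.card {x // x ∈ A ∧ ∃ y ∈ B, R x y}

/-- The size of the sets that nodes of class `c` select. -/
def setSize (τ c : ℕ) : ℕ := 8 * 2 ^ c * τ

/-- The size of the blocks from each of which a candidate set of class `c` contains one color. It is
`8 * D * setSize τ c / τ`, so that a random candidate set is expected to have at most `τ / 8` colors
that are related to a given candidate set of the same or a smaller class. -/
def blockSize (D c : ℕ) : ℕ := 64 * D * 2 ^ c

/-- The size of the shrunken lists of nodes of class `c`. -/
def listSize (D τ c : ℕ) : ℕ := setSize τ c * blockSize D c

theorem listSize_mono {D τ c c' : ℕ} (h : c ≤ c') : listSize D τ c ≤ listSize D τ c' := by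
  unfold listSize setSize blockSize
  gcongr <;> norm_num

/-- A list of `k * n` colors, cut into `k` blocks of size `n`. -/
noncomputable def blockEquiv (L : Finset ℕ) (k n : ℕ) (h : L.card = k * n) :
    Fin k × Fin n ≃ L :=
  (finProdFinEquiv.trans (finCongr h.symm)).trans L.equivFin.symm

/-- The set that contains the color number `ω r` of every block `r`. -/
noncomputable def transversal (L : Finset ℕ) (k n : ℕ) (h : L.card = k * n) (ω : Fin k → Fin n) :
    Finset ℕ :=
  univ.image fun r => (blockEquiv L k n h (r, ω r) : ℕ)

theorem transversal_subset (L : Finset ℕ) (k n : ℕ) (h : L.card = k * n) (ω : Fin k → Fin n) :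
    transversal L k n h ω ⊆ L := by
  intro x hx
  simp only [transversal, Finset.mem_image, Finset.mem_univ, true_and] at hx
  obtain ⟨r, rfl⟩ := hx
  exact Finset.coe_mem _

theorem card_transversal (L : Finset ℕ) (k n : ℕ) (h : L.card = k * n) (ω : Fin k → Fin n) :
    (transversal L k n h ω).card = k := by
  rw [transversal, Finset.card_image_of_injective, Finset.card_univ, Fintype.card_fin]
  intro r r' hrr
  have := (blockEquiv L k n h).injective (Subtype.ext hrr)
  exact (Prod.ext_iff.1 this).1

theorem card_related_le {X : Finset ℕ} {R : ℕ → ℕ → Prop} {D : ℕ}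
    (hR : ∀ y, Nat.card {x // x ∈ X ∧ R x y} ≤ D) {L B : Finset ℕ} (hL : L ⊆ X) :
    Nat.card {x // x ∈ L ∧ ∃ y ∈ B, R x y} ≤ B.card * D := by
  classical
  rw [natCard_mem_and]
  calc _ ≤ (B.biUnion fun y => X.filter fun x => R x y).card := by
        refine Finset.card_le_card fun x hx => ?_
        obtain ⟨hx, y, hy, hxy⟩ := Finset.mem_filter.1 hx
        simp only [Finset.mem_biUnion, Finset.mem_filter]
        exact ⟨y, hy, hL hx, hxy⟩
    _ ≤ _ := Finset.card_biUnion_le_card_mul _ _ _ fun y _ => by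
        rw [← natCard_mem_and]; exact hR y

/-- A random transversal of `L` is in conflict with a fixed set `B` with probability at most
`2 ^ (-τ)`. -/
theorem card_transversal_conflict_le {X : Finset ℕ} {R : ℕ → ℕ → Prop} {D τ c : ℕ} (hD : 0 < D)
    (hR : ∀ y, Nat.card {x // x ∈ X ∧ R x y} ≤ D) {L B : Finset ℕ} (hL : L ⊆ X)
    (h : L.card = setSize τ c * blockSize D c) (hB : B.card ≤ setSize τ c) :
    Nat.card {ω : Fin (setSize τ c) → Fin (blockSize D c) //
      Conflict R τ (transversal L _ _ h ω) B} * 2 ^ τ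
      ≤ Fintype.card (Fin (setSize τ c) → Fin (blockSize D c)) := by
  classical
  have : NeZero (blockSize D c) := ⟨by unfold blockSize; positivity⟩
  let Bd : Fin (setSize τ c) → Finset (Fin (blockSize D c)) := fun r =>
    univ.filter fun x => ∃ y ∈ B, R (blockEquiv L _ _ h (r, x)) y
  have hsum : ∑ r, (Bd r).card = Nat.card {x // x ∈ L ∧ ∃ y ∈ B, R x y} := by
    have e1 : ∑ r, (Bd r).card = (univ.filter fun z : Fin (setSize τ c) × Fin (blockSize D c) =>
        ∃ y ∈ B, R (blockEquiv L _ _ h z) y).card := by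
      rw [Finset.card_filter, ← Finset.univ_product_univ, Finset.sum_product]
      refine Finset.sum_congr rfl fun r _ => ?_
      rw [Finset.card_filter]
    rw [e1, ← Fintype.card_subtype, ← Nat.card_eq_fintype_card]
    refine Nat.card_congr (((blockEquiv L _ _ h).subtypeEquiv
      (q := fun x : L => ∃ y ∈ B, R x y) fun a => Iff.rfl).trans
      (Equiv.subtypeSubtypeEquivSubtypeInter (fun x => x ∈ L) fun x => ∃ y ∈ B, R x y))
  have h8 : 8 * ∑ r, (Bd r).card ≤ τ * Fintype.card (Fin (blockSize D c)) := by
    rw [hsum, Fintype.card_fin]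
    calc _ ≤ 8 * (setSize τ c * D) :=
          Nat.mul_le_mul_left _ ((card_related_le hR hL).trans (Nat.mul_le_mul_right _ hB))
      _ = _ := by unfold setSize blockSize; ring
  refine le_trans (Nat.mul_le_mul_right _ ?_) (card_many_hits_mul_two_pow_le Bd τ h8)
  rw [Nat.card_eq_fintype_card, Fintype.card_subtype]
  refine Finset.card_le_card fun ω hω => ?_
  simp only [Finset.mem_filter, Finset.mem_univ, true_and] at hω ⊢
  refine le_trans hω ?_
  rw [natCard_mem_and, transversal, Finset.filter_image]
  refine Finset.card_image_le.trans (le_of_eq ?_)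
  simp [Bd]

/-- Candidate sets `F a c L i` for nodes of initial color `a`, class `c` and list `L`, such that only
`τ'` candidate sets of a node are in conflict with some candidate set of a given neighbor of the same
or a smaller class. The hypothesis `htypes` makes the union bound over the pairs of triples
`(a, c, L)` work, and `hτ` keeps the expected number of conflicting candidate sets below
`τ' / 8`. -/
theorem exists_families (X : Finset ℕ) (m H τ τ' D : ℕ) (R : ℕ → ℕ → Prop) (hD : 0 < D)
    (hR : ∀ y, Nat.card {x // x ∈ X ∧ R x y} ≤ D)
    (htypes : (H * (m * (X.card + 1) ^ listSize D τ H)) ^ 2 < 2 ^ τ')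
    (hτ : 512 * 4 ^ H * τ' ≤ 2 ^ τ) :
    ∃ F : ℕ → ℕ → Finset ℕ → Fin (8 * 2 ^ H * τ') → Finset ℕ,
      (∀ a c L, a < m → c < H → L ⊆ X → L.card = listSize D τ c → ∀ i,
        F a c L i ⊆ L ∧ (F a c L i).card = setSize τ c) ∧
      ∀ a c L, a < m → c < H → L ⊆ X → L.card = listSize D τ c →
      ∀ a' c' L', a' < m → c' ≤ c → L' ⊆ X → L'.card = listSize D τ c' → a ≠ a' →
        Nat.card {i // ∃ j, Conflict R τ (F a c L i) (F a' c' L' j)} ≤ τ' := by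
  classical
  let T := Σ c : Fin H, Fin m × {L // L ∈ X.powersetCard (listSize D τ c)}
  have hLc : ∀ t : T, (t.2.2 : Finset ℕ).card = setSize τ t.1 * blockSize D t.1 := fun t =>
    (Finset.mem_powersetCard.1 t.2.2.2).2
  have hLX : ∀ t : T, (t.2.2 : Finset ℕ) ⊆ X := fun t =>
    (Finset.mem_powersetCard.1 t.2.2.2).1
  let Ω : T → Type := fun t =>
    Fin (8 * 2 ^ H * τ') → Fin (setSize τ t.1) → Fin (blockSize D t.1)
  have : ∀ t : T, NeZero (blockSize D t.1) := fun t => ⟨by unfold blockSize; positivity⟩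
  let S : ∀ t : T, (Fin (setSize τ t.1) → Fin (blockSize D t.1)) → Finset ℕ := fun t ω =>
    transversal t.2.2 _ _ (hLc t) ω
  let bad : ∀ t t', Ω t → Ω t' → Prop := fun t t' ω ω' =>
    t'.1 ≤ t.1 ∧ τ' ≤ (univ.filter fun i => ∃ j, Conflict R τ (S t (ω i)) (S t' (ω' j))).card
  have hcard : Fintype.card T ^ 2 < 2 ^ τ' := by
    refine lt_of_le_of_lt (Nat.pow_le_pow_left ?_ 2) htypes
    simp only [T, Fintype.card_sigma, Fintype.card_prod, Fintype.card_fin, Fintype.card_coe,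
      Finset.card_powersetCard]
    calc _ ≤ ∑ c : Fin H, m * (X.card + 1) ^ listSize D τ H := by
          refine Finset.sum_le_sum fun c _ => Nat.mul_le_mul_left _ ?_
          calc X.card.choose (listSize D τ c) ≤ X.card ^ listSize D τ c := Nat.choose_le_pow _ _
            _ ≤ (X.card + 1) ^ listSize D τ c := Nat.pow_le_pow_left (Nat.le_succ _) _
            _ ≤ _ := Nat.pow_le_pow_right (Nat.succ_pos _) (listSize_mono c.2.le)
      _ = _ := by simp
  obtain ⟨ω, hω⟩ := exists_forall_not_of_card_mul_le Ω bad (2 ^ τ') hcard (by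
    intro t t' _ ω'
    by_cases hc : t'.1 ≤ t.1
    swap
    · have : IsEmpty {x : Ω t // bad t t' x ω'} := ⟨fun x => hc x.2.1⟩
      simp
    -- the samples for `t` that are in conflict with some candidate set of `t'`
    let Bd : Finset (Fin (setSize τ t.1) → Fin (blockSize D t.1)) :=
      univ.filter fun w => ∃ j, Conflict R τ (S t w) (S t' (ω' j))
    have hBd : Bd.card * 2 ^ τ ≤ (8 * 2 ^ H * τ') *
        Fintype.card (Fin (setSize τ t.1) → Fin (blockSize D t.1)) := by
      have hsub : Bd ⊆ univ.biUnion fun j => univ.filter fun w => Conflict R τ (S t w) (S t' (ω' j)) := by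
        intro w hw
        simpa [Bd] using hw
      have h1 := (Finset.card_le_card hsub).trans Finset.card_biUnion_le
      calc _ ≤ (∑ j, (univ.filter fun w => Conflict R τ (S t w) (S t' (ω' j))).card) * 2 ^ τ :=
            Nat.mul_le_mul_right _ h1
        _ ≤ ∑ j : Fin (8 * 2 ^ H * τ'),
              Fintype.card (Fin (setSize τ t.1) → Fin (blockSize D t.1)) := by
            rw [Finset.sum_mul]
            refine Finset.sum_le_sum fun j _ => ?_
            rw [← Fintype.card_subtype, ← Nat.card_eq_fintype_card]
            refine card_transversal_conflict_le hD hR (hLX t) (hLc t) ?_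
            rw [card_transversal]
            unfold setSize
            have : (t'.1 : ℕ) ≤ t.1 := hc
            gcongr
            norm_num
        _ = _ := by simp
    have h8 : 8 * ∑ _i : Fin (8 * 2 ^ H * τ'), Bd.card
        ≤ τ' * Fintype.card (Fin (setSize τ t.1) → Fin (blockSize D t.1)) := by
      simp only [Finset.sum_const, Finset.card_univ, Fintype.card_fin, smul_eq_mul]
      refine Nat.le_of_mul_le_mul_right (c := 2 ^ τ) ?_ (by positivity)
      calc 8 * (8 * 2 ^ H * τ' * Bd.card) * 2 ^ τ
          = (8 * (8 * 2 ^ H * τ')) * (Bd.card * 2 ^ τ) := by ring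
        _ ≤ (8 * (8 * 2 ^ H * τ')) * ((8 * 2 ^ H * τ') *
              Fintype.card (Fin (setSize τ t.1) → Fin (blockSize D t.1))) :=
            Nat.mul_le_mul_left _ hBd
        _ = τ' * Fintype.card (Fin (setSize τ t.1) → Fin (blockSize D t.1)) *
              (512 * 4 ^ H * τ') := by
            have : (4 : ℕ) ^ H = 2 ^ H * 2 ^ H := by rw [← mul_pow]; norm_num
            rw [this]; ring
        _ ≤ _ := Nat.mul_le_mul_left _ hτ
    refine le_trans (Nat.mul_le_mul_right _ ?_) (card_many_hits_mul_two_pow_le (fun _ => Bd) τ' h8)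
    rw [Nat.card_eq_fintype_card, Fintype.card_subtype]
    refine Finset.card_le_card fun w hw => ?_
    simp only [Finset.mem_filter, Finset.mem_univ, true_and, bad] at hw ⊢
    refine hw.2.trans (le_of_eq ?_)
    simp [Bd])
  let tp : ∀ a c L, a < m → c < H → L ⊆ X → L.card = listSize D τ c → T :=
    fun a c L ha hc hL hcd => ⟨⟨c, hc⟩, ⟨a, ha⟩, ⟨L, Finset.mem_powersetCard.2 ⟨hL, hcd⟩⟩⟩
  let F : ℕ → ℕ → Finset ℕ → Fin (8 * 2 ^ H * τ') → Finset ℕ := fun a c L i =>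
    if h : a < m ∧ c < H ∧ L ⊆ X ∧ L.card = listSize D τ c then
      S (tp a c L h.1 h.2.1 h.2.2.1 h.2.2.2) (ω (tp a c L h.1 h.2.1 h.2.2.1 h.2.2.2) i)
    else ∅
  have hF : ∀ a c L (ha : a < m) (hc : c < H) (hL : L ⊆ X) (hcd : L.card = listSize D τ c) i,
      F a c L i = S (tp a c L ha hc hL hcd) (ω (tp a c L ha hc hL hcd) i) :=
    fun a c L ha hc hL hcd i => dif_pos ⟨ha, hc, hL, hcd⟩
  refine ⟨F, fun a c L ha hc hL hcd i => ?_, fun a c L ha hc hL hcd a' c' L' ha' hc' hL' hcd' haa => ?_⟩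
  · rw [hF a c L ha hc hL hcd i]
    exact ⟨transversal_subset _ _ _ _ _, card_transversal _ _ _ _ _⟩
  · have hne : tp a c L ha hc hL hcd ≠ tp a' c' L' ha' (hc'.trans_lt hc) hL' hcd' := by
      intro h
      have h1 : (tp a c L ha hc hL hcd).2.1 = (tp a' c' L' ha' (hc'.trans_lt hc) hL' hcd').2.1 := by
        rw [h]
      exact haa (congrArg Fin.val h1)
    have h2 := hω _ _ hne
    simp only [bad, not_and, not_le] at h2
    have h3 := h2 hc'
    rw [Nat.card_eq_fintype_card, Fintype.card_subtype]
    simp only [hF a c L ha hc hL hcd, hF a' c' L' ha' (hc'.trans_lt hc) hL' hcd']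
    exact h3.le

end Families

/-! ### Local rules -/

section Rules

variable {V : Type*} [Fintype V] {M I I₁ I₂ : Type} [Inhabited M]

/-- A rule that determines the message a node sends to all its neighbors in round `t`, given its input,
the messages it has sent so far, and the multiset of the sequences of messages it has received from
its outneighbors. Rules ignore inneighbors and the identity of the ports. A sequence of messages is
extended by `default` to the rounds that have not yet taken place. -/
abbrev Rule (I M : Type) : Type := ℕ → I → (ℕ → M) → Multiset (ℕ → M) → M

/-- The messages that the nodes have sent in the first `t` rounds. -/
noncomputable def hist (G : Digraph V) (r : Rule I M) (inp : V → I) : ℕ → V → ℕ → M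
  | 0 => fun _ _ => default
  | t + 1 => fun v => Function.update (hist G r inp t v) t
      (r t (inp v) (hist G r inp t v) ((outNbrs G v).val.map (hist G r inp t)))

/-- The message that `v` sends in round `t`. -/
noncomputable def msg (G : Digraph V) (r : Rule I M) (inp : V → I) (t : ℕ) (v : V) : M :=
  r t (inp v) (hist G r inp t v) ((outNbrs G v).val.map (hist G r inp t))

theorem hist_succ (G : Digraph V) (r : Rule I M) (inp : V → I) (t : ℕ) (v : V) :
    hist G r inp (t + 1) v = Function.update (hist G r inp t v) t (msg G r inp t v) := rfl

theorem hist_apply (G : Digraph V) (r : Rule I M) (inp : V → I) (t : ℕ) (v : V) (s : ℕ) :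
    hist G r inp t v s = if s < t then msg G r inp s v else default := by
  induction t with
  | zero => rfl
  | succ t ih =>
    rw [hist_succ, Function.update_apply]
    split_ifs with h1 h2 h2
    · rw [h1]
    · omega
    · rw [ih, if_pos (by omega)]
    · rw [ih, if_neg (by omega)]

theorem hist_of_lt (G : Digraph V) (r : Rule I M) (inp : V → I) {t s : ℕ} (v : V) (h : s < t) :
    hist G r inp t v s = msg G r inp s v := by
  rw [hist_apply, if_pos h]

/-- Sequential composition: `r₁` for `T` rounds, then `r₂`. The input of the second rule may depend on
the messages that the node itself has sent while executing the first rule. -/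
noncomputable def Rule.seq (T : ℕ) (r₁ : Rule I₁ M) (r₂ : Rule I₂ M) (in₁ : I → I₁)
    (in₂ : I → (ℕ → M) → I₂) : Rule I M := fun t i own S =>
  if t < T then r₁ t (in₁ i) own S
  else r₂ (t - T) (in₂ i fun s => if s < T then own s else default) (fun s => own (T + s))
    (S.map fun w s => w (T + s))

variable (G : Digraph V) (T : ℕ) (r₁ : Rule I₁ M) (r₂ : Rule I₂ M) (in₁ : I → I₁)
  (in₂ : I → (ℕ → M) → I₂) (inp : V → I)

theorem hist_seq_of_le {t : ℕ} (h : t ≤ T) :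
    hist G (r₁.seq T r₂ in₁ in₂) inp t = hist G r₁ (fun v => in₁ (inp v)) t := by
  induction t with
  | zero => rfl
  | succ t ih =>
    funext v
    rw [hist_succ, hist_succ, msg, msg, ih (by omega), Rule.seq, if_pos (by omega)]

theorem msg_seq_of_lt {t : ℕ} (h : t < T) (v : V) :
    msg G (r₁.seq T r₂ in₁ in₂) inp t v = msg G r₁ (fun v => in₁ (inp v)) t v := by
  rw [msg, msg, hist_seq_of_le _ _ _ _ _ _ _ h.le, Rule.seq, if_pos h]

theorem msg_seq_add_of_hist {t : ℕ}
    (ih : ∀ v, (fun s => hist G (r₁.seq T r₂ in₁ in₂) inp (T + t) v (T + s))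
      = hist G r₂ (fun v => in₂ (inp v) (hist G r₁ (fun v => in₁ (inp v)) T v)) t v) (v : V) :
    msg G (r₁.seq T r₂ in₁ in₂) inp (T + t) v
      = msg G r₂ (fun v => in₂ (inp v) (hist G r₁ (fun v => in₁ (inp v)) T v)) t v := by
  have h1 : (fun s => if s < T then hist G (r₁.seq T r₂ in₁ in₂) inp (T + t) v s else default)
      = hist G r₁ (fun v => in₁ (inp v)) T v := by
    funext s
    rw [hist_apply, hist_apply]
    split_ifs
    · rw [msg_seq_of_lt _ _ _ _ _ _ _ ‹_›]
    · omega
    · rfl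
  rw [msg, Rule.seq, if_neg (by omega), Nat.add_sub_cancel_left, h1, ih, msg, Multiset.map_map]
  congr 1
  refine Multiset.map_congr rfl fun u _ => ?_
  exact ih u

theorem hist_seq_add (t : ℕ) (v : V) :
    (fun s => hist G (r₁.seq T r₂ in₁ in₂) inp (T + t) v (T + s))
      = hist G r₂ (fun v => in₂ (inp v) (hist G r₁ (fun v => in₁ (inp v)) T v)) t v := by
  induction t generalizing v with
  | zero =>
    funext s
    rw [hist_apply, if_neg (by omega)]
    rfl
  | succ t ih =>
    funext s
    have := msg_seq_add_of_hist G T r₁ r₂ in₁ in₂ inp ih v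
    rw [hist_succ, ← add_assoc, hist_succ, this, ← ih v, Function.update_apply,
      Function.update_apply]
    simp

theorem msg_seq_add (t : ℕ) (v : V) :
    msg G (r₁.seq T r₂ in₁ in₂) inp (T + t) v
      = msg G r₂ (fun v => in₂ (inp v) (hist G r₁ (fun v => in₁ (inp v)) T v)) t v :=
  msg_seq_add_of_hist G T r₁ r₂ in₁ in₂ inp (hist_seq_add G T r₁ r₂ in₁ in₂ inp t) v

end Rules

/-! ### Realizing local rules by distributed algorithms -/

section Realization

variable {V : Type*} [Fintype V] {C : Finset ℕ} {m : ℕ} {M : Type} [Inhabited M]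

theorem bits_injective : Function.Injective Nat.bits := by
  intro a b h
  have := congrArg (fun l : List Bool => l.foldr Nat.bit 0) h
  have key : ∀ n : ℕ, (Nat.bits n).foldr Nat.bit 0 = n := by
    intro n
    induction n using Nat.binaryRec' with
    | zero => simp
    | bit b n h ih => rw [Nat.bits_append_bit _ _ h, List.foldr_cons, ih]
  simpa [key] using this

open Classical in
/-- The ports that lead to outneighbors. -/
noncomputable def outPorts (i : NodeInput) : Finset ℕ :=
  (univ.filter i.isOut).map Fin.valEmbedding

/-- The state of a node that executes a rule: its input, the number of rounds so far, the messages it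
has sent, and the messages it has received, by port and round. -/
structure RuleState (M : Type) where
  input : NodeInput
  time : ℕ
  own : ℕ → M
  recv : ℕ → ℕ → M

/-- The message that a node in state `s` sends next. -/
noncomputable def RuleState.next (r : Rule NodeInput M) (s : RuleState M) : M :=
  r s.time s.input s.own ((outPorts s.input).val.map fun p => s.recv p)

/-- The distributed algorithm that executes `r` for `T` rounds and then outputs a color that depends on
the input of the node and the messages it has sent. The messages of round `t` are encoded as numbers
by `enc t`, and these as bit strings. -/
noncomputable def Rule.toAlgorithm (r : Rule NodeInput M) (enc : ℕ → M → ℕ)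
    (T : ℕ) (out : NodeInput → (ℕ → M) → ℕ) : Algorithm where
  State := RuleState M
  init i := ⟨i, 0, default, default⟩
  send s _ := Nat.bits (enc s.time (s.next r))
  receive s inbox := ⟨s.input, s.time + 1, Function.update s.own s.time (s.next r),
    fun p => Function.update (s.recv p) s.time
      (Function.invFun (fun x => Nat.bits (enc s.time x)) (inbox p))⟩
  output s := if T ≤ s.time then some (out s.input s.own) else none

theorem outPorts_map (N : Network V C m) (v : V) {α : Type*} (f : V → α) (g : ℕ → α)
    (h : ∀ p : Fin (nbrs N.graph v).card, g p = f (N.port v p)) :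
    (outPorts (N.input v)).val.map g = (outNbrs N.graph v).val.map f := by
  classical
  let P : Finset (Fin (nbrs N.graph v).card) := univ.filter fun p => N.graph.Adj v (N.port v p)
  have h1 : outPorts (N.input v) = P.map Fin.valEmbedding := by
    unfold outPorts
    congr!
  have h2 : outNbrs N.graph v =
      P.map ((N.port v).toEmbedding.trans (Function.Embedding.subtype _)) := by
    ext u
    simp only [outNbrs, P, Finset.mem_filter, Finset.mem_univ, true_and, Finset.mem_map]
    constructor
    · intro hu
      have hu' : u ∈ nbrs N.graph v := by simp [nbrs, hu]
      exact ⟨(N.port v).symm ⟨u, hu'⟩, by simpa using hu, by simp⟩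
    · rintro ⟨p, hp, rfl⟩
      exact hp
  rw [h1, h2, Finset.map_val, Finset.map_val, Multiset.map_map, Multiset.map_map]
  exact Multiset.map_congr rfl fun p _ => h p

theorem card_outPorts (N : Network V C m) (v : V) :
    (outPorts (N.input v)).card = (outNbrs N.graph v).card := by
  have := congrArg Multiset.card (outPorts_map N v (fun _ => ()) (fun _ => ()) fun _ => rfl)
  rwa [Multiset.card_map, Multiset.card_map] at this

theorem Algorithm.state_succ_of_none (A : Algorithm) (N : Network V C m) (t : ℕ) (v : V)
    (h : A.output (A.state N t v) = none) :
    A.state N (t + 1) v = A.receive (A.state N t v) (A.inbox N (A.state N t) v) :=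
  if_neg (by simp [h])

theorem RuleState.next_eq_msg (N : Network V C m) (r : Rule NodeInput M) (t : ℕ) (v : V)
    (rc : ℕ → ℕ → M)
    (hrc : ∀ p : Fin (nbrs N.graph v).card, rc p = hist N.graph r N.input t (N.port v p)) :
    RuleState.next r ⟨N.input v, t, hist N.graph r N.input t v, rc⟩ = msg N.graph r N.input t v := by
  rw [RuleState.next, msg]
  congr 1
  exact outPorts_map N v _ _ hrc

/-- The distributed algorithm computes the histories `hist`. Only the entries of `rc` at existing ports
are meaningful. -/
theorem state_toAlgorithm (N : Network V C m) (r : Rule NodeInput M) (enc : ℕ → M → ℕ)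
    (henc : ∀ t, Function.Injective (enc t)) (T : ℕ) (out : NodeInput → (ℕ → M) → ℕ)
    (t : ℕ) (ht : t ≤ T) (v : V) :
    ∃ rc : ℕ → ℕ → M, (r.toAlgorithm enc T out).state N t v
        = (⟨N.input v, t, hist N.graph r N.input t v, rc⟩ : RuleState M) ∧
      ∀ p : Fin (nbrs N.graph v).card, rc p = hist N.graph r N.input t (N.port v p) := by
  induction t generalizing v with
  | zero => exact ⟨default, rfl, fun p => rfl⟩
  | succ t ih =>
    choose rc hst hrc using ih (by omega)
    have hout : ∀ v, (r.toAlgorithm enc T out).output ((r.toAlgorithm enc T out).state N t v)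
        = none := by
      intro v
      rw [hst]
      exact if_neg (by show ¬ T ≤ t; omega)
    refine ⟨fun p => Function.update (rc v p) t (Function.invFun (fun x => Nat.bits (enc t x))
      ((r.toAlgorithm enc T out).inbox N ((r.toAlgorithm enc T out).state N t) v p)),
      ?_, fun p => ?_⟩
    · refine (Algorithm.state_succ_of_none _ N t v (hout v)).trans ?_
      rw [hst v]
      refine RuleState.mk.injEq .. |>.mpr ⟨rfl, rfl, ?_, rfl⟩
      show Function.update _ t _ = _
      rw [RuleState.next_eq_msg N r t v _ (hrc v), hist_succ]
    · show Function.update (rc v p) t _ = _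
      rw [hrc v p, hist_succ]
      congr 1
      show Function.invFun _ _ = _
      have : (r.toAlgorithm enc T out).inbox N ((r.toAlgorithm enc T out).state N t) v p
          = Nat.bits (enc t (msg N.graph r N.input t (N.port v p))) := by
        rw [Algorithm.inbox, dif_pos p.2, Algorithm.outgoing, if_neg (by simp [hout]), hst]
        show Nat.bits (enc t (RuleState.next r _)) = _
        rw [RuleState.next_eq_msg N r t _ _ (hrc _)]
      rw [this]
      exact Function.leftInverse_invFun (bits_injective.comp (henc t)) _

theorem toAlgorithm_output (N : Network V C m) (r : Rule NodeInput M) (enc : ℕ → M → ℕ)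
    (henc : ∀ t, Function.Injective (enc t)) (T : ℕ) (out : NodeInput → (ℕ → M) → ℕ) (v : V) :
    (r.toAlgorithm enc T out).output ((r.toAlgorithm enc T out).state N T v)
      = some (out (N.input v) (hist N.graph r N.input T v)) := by
  obtain ⟨rc, h, -⟩ := state_toAlgorithm N r enc henc T out T le_rfl v
  rw [h]
  exact if_pos le_rfl

theorem toAlgorithm_messages (N : Network V C m) (r : Rule NodeInput M) (enc : ℕ → M → ℕ)
    (henc : ∀ t, Function.Injective (enc t)) (T : ℕ) (out : NodeInput → (ℕ → M) → ℕ) (B : ℝ)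
    (hB0 : 0 ≤ B)
    (hB : ∀ t < T, ∀ v, (Nat.size (enc t (msg N.graph r N.input t v)) : ℝ) ≤ B) :
    (r.toAlgorithm enc T out).UsesMessagesOfSize N B := by
  -- From time `T` on all nodes have terminated.
  have hlate : ∀ t, T ≤ t → ∀ v, (r.toAlgorithm enc T out).state N t v
      = (r.toAlgorithm enc T out).state N T v := by
    intro t ht v
    induction t, ht using Nat.le_induction with
    | base => rfl
    | succ t ht ih =>
      rw [Algorithm.state]
      beta_reduce
      rw [ih, if_pos]
      rw [toAlgorithm_output N r enc henc]
      rfl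
  intro t v p
  obtain ht | ht := le_or_gt T t
  · rw [hlate t ht, Algorithm.outgoing, if_pos]
    · simpa using hB0
    · rw [toAlgorithm_output N r enc henc]
      rfl
  · obtain ⟨rc, hst, hrc⟩ := state_toAlgorithm N r enc henc T out t ht.le v
    rw [Algorithm.outgoing]
    split_ifs
    · simpa using hB0
    · rw [hst]
      change ((Nat.bits (enc t (RuleState.next r _))).length : ℝ) ≤ B
      rw [RuleState.next_eq_msg N r t v rc hrc, Nat.size_eq_bits_len]
      exact hB t ht v

end Realization

/-! ### Averaging -/

section Averaging

open Classical in
theorem sum_card_filter_le {α β : Type*} (A : Finset α) (U : Finset β) (Q : α → β → Prop) (q : ℕ)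
    (h : ∀ u ∈ U, (A.filter fun a => Q a u).card ≤ q) :
    ∑ a ∈ A, (U.filter fun u => Q a u).card ≤ U.card * q := by
  calc ∑ a ∈ A, (U.filter fun u => Q a u).card = ∑ u ∈ U, (A.filter fun a => Q a u).card :=
        Finset.sum_card_bipartiteAbove_eq_sum_card_bipartiteBelow Q
    _ ≤ _ := by
        rw [← smul_eq_mul]
        exact Finset.sum_le_card_nsmul _ _ _ h

theorem exists_mul_card_le_sum {α : Type*} (A : Finset α) (hA : A.Nonempty) (f : α → ℕ) :
    ∃ a ∈ A, f a * A.card ≤ ∑ a ∈ A, f a := by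
  obtain ⟨a, ha, hmin⟩ := A.exists_min_image f hA
  refine ⟨a, ha, ?_⟩
  rw [mul_comm, ← smul_eq_mul]
  exact Finset.card_nsmul_le_sum _ _ _ hmin

theorem exists_subset_mul_le {α : Type*} (A : Finset α) (f : α → ℕ) (ℓ S : ℕ)
    (hA : 2 * ℓ ≤ A.card) (hS : ∑ a ∈ A, f a ≤ S) :
    ∃ B ⊆ A, B.card = ℓ ∧ ∀ a ∈ B, f a * ℓ ≤ S := by
  classical
  -- By averaging, at most `ℓ` elements exceed the bound.
  set Bd := A.filter fun a => S < f a * ℓ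
  have h1 : Bd.card ≤ ℓ := by
    by_contra! hlt
    have h2 : Bd.card * (S + 1) ≤ S * ℓ := by
      calc Bd.card * (S + 1) ≤ ∑ a ∈ Bd, f a * ℓ := by
            rw [← smul_eq_mul]
            exact Finset.card_nsmul_le_sum _ _ _ fun a ha => (Finset.mem_filter.1 ha).2
        _ ≤ (∑ a ∈ A, f a) * ℓ := by
            rw [← Finset.sum_mul]
            exact Nat.mul_le_mul_right _ (Finset.sum_le_sum_of_subset (Finset.filter_subset _ _))
        _ ≤ _ := Nat.mul_le_mul_right _ hS
    nlinarith
  have h2 : ℓ ≤ (A \ Bd).card := by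
    have := Finset.le_card_sdiff Bd A
    omega
  obtain ⟨B, hB, hc⟩ := Finset.exists_subset_card_eq h2
  refine ⟨B, hB.trans Finset.sdiff_subset, hc, fun a ha => ?_⟩
  have := hB ha
  simp only [Bd, Finset.mem_sdiff, Finset.mem_filter, not_and, not_lt] at this
  exact this.2 this.1

end Averaging

/-! ### The core algorithm -/

section CoreAlgorithm

/-- A message of the core algorithm: the initial color and the class of the sender, and a set of
colors. The input of a node has the same format, with its list as `set`. -/
structure Msg where
  color : ℕ
  cls : ℕ
  set : Finset ℕ

instance : Inhabited Msg := ⟨⟨0, 0, ∅⟩⟩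

open Classical in
/-- The number of elements of `S` with property `p`. -/
noncomputable def count {α : Type*} (S : Multiset α) (p : α → Prop) : ℕ := S.countP p

open Classical in
theorem count_map {α β : Type*} (A : Finset α) (f : α → β) (p : β → Prop) :
    count (A.val.map f) p = (A.filter fun a => p (f a)).card := by
  rw [count, Multiset.countP_map]
  rfl

open Classical in
/-- Some set with property `p`, or `∅` if there is none. -/
noncomputable def pickSet (p : Finset ℕ → Prop) : Finset ℕ :=
  if h : ∃ A, p A then h.choose else ∅

open Classical in
/-- The singleton of some color with property `p`, or `∅` if there is none. -/
noncomputable def pickColor (p : ℕ → Prop) : Finset ℕ :=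
  if h : ∃ x, p x then {h.choose} else ∅

theorem pickSet_spec {p : Finset ℕ → Prop} (h : ∃ A, p A) : p (pickSet p) := by
  rw [pickSet, dif_pos h]
  exact h.choose_spec

theorem pickSet_eq_empty_or (p : Finset ℕ → Prop) : pickSet p = ∅ ∨ p (pickSet p) := by
  by_cases h : ∃ A, p A
  · exact Or.inr (pickSet_spec h)
  · exact Or.inl (dif_neg h)

theorem pickColor_spec {p : ℕ → Prop} (h : ∃ x, p x) : ∃ x, p x ∧ pickColor p = {x} :=
  ⟨h.choose, h.choose_spec, dif_pos h⟩

theorem pickColor_eq_empty_or (p : ℕ → Prop) :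
    pickColor p = ∅ ∨ ∃ x, p x ∧ pickColor p = {x} := by
  by_cases h : ∃ A, p A
  · exact Or.inr (pickColor_spec h)
  · exact Or.inl (dif_neg h)

/-- The parameters of the core algorithm: the color space `X`, the number `m` of initial colors, the
number `H` of classes, the gap `g` beyond which a class counts as much smaller, the threshold `τ` for
conflicts, the bound `q` on the number of conflicting candidate sets, the bound `D` on the degree of
the relation `R`, and the families `F` of candidate sets. -/
structure Core where
  X : Finset ℕ
  m : ℕ
  H : ℕ
  g : ℕ
  τ : ℕ
  q : ℕ
  D : ℕ
  R : ℕ → ℕ → Prop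
  F : ℕ → ℕ → Finset ℕ → Fin (8 * 2 ^ H * q) → Finset ℕ

namespace Core

/-- The properties of the parameters on which the correctness of the core algorithm depends. -/
structure Valid (P : Core) : Prop where
  D_pos : 0 < P.D
  τ_pos : 0 < P.τ
  q_pos : 0 < P.q
  card_related : ∀ y, Nat.card {x // x ∈ P.X ∧ P.R x y} ≤ P.D
  family : ∀ a c L, a < P.m → c < P.H → L ⊆ P.X → L.card = listSize P.D P.τ c → ∀ i,
    P.F a c L i ⊆ L ∧ (P.F a c L i).card = setSize P.τ c
  conflict : ∀ a c L, a < P.m → c < P.H → L ⊆ P.X → L.card = listSize P.D P.τ c →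
    ∀ a' c' L', a' < P.m → c' ≤ c → L' ⊆ P.X → L'.card = listSize P.D P.τ c' → a ≠ a' →
      Nat.card {i // ∃ j, Conflict P.R P.τ (P.F a c L i) (P.F a' c' L' j)} ≤ P.q

variable (P : Core)

/-- The shrunken list in the sequence `w` of the messages of a node; it is sent in round `2 * c` by
nodes of class `c`. -/
def listOf (w : ℕ → Msg) : Finset ℕ := (w (2 * (w 0).cls)).set

/-- The selected set in the sequence `w` of the messages of a node. -/
def setOf (w : ℕ → Msg) : Finset ℕ := (w (2 * (w 0).cls + 1)).set

/-- The singleton of the selected color in the sequence `w` of the messages of a node. Nodes of class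
`c` send it in round `3 * H - c`. -/
def finalOf (w : ℕ → Msg) : Finset ℕ := (w (3 * P.H - (w 0).cls)).set

/-- An outneighbor of class much smaller than `c` whose selected set contains a color to which `x` is
related. -/
def Low (c x : ℕ) (w : ℕ → Msg) : Prop :=
  (w 0).cls + P.g < c ∧ ∃ z ∈ setOf w, P.R x z

/-- An outneighbor of class at most, but not much smaller than, `c`. -/
def Mid (c : ℕ) (w : ℕ → Msg) : Prop := (w 0).cls ≤ c ∧ c ≤ (w 0).cls + P.g

/-- The set `A` is in conflict with a candidate set of the outneighbor. -/
def Bad (A : Finset ℕ) (w : ℕ → Msg) : Prop :=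
  ∃ j, Conflict P.R P.τ A (P.F (w 0).color (w 0).cls (listOf w) j)

/-- The requirement on the shrunken list `L`. -/
def ListSpec (inp : Msg) (S : Multiset (ℕ → Msg)) (L : Finset ℕ) : Prop :=
  L ⊆ inp.set ∧ L.card = listSize P.D P.τ inp.cls ∧ ∀ x ∈ L,
    count S (P.Low inp.cls x) * (64 * 2 ^ inp.cls * 2 ^ P.g) ≤ S.card

/-- The requirement on the selected set `A`, given the shrunken list `L`. -/
def SetSpec (inp : Msg) (L : Finset ℕ) (S : Multiset (ℕ → Msg)) (A : Finset ℕ) : Prop :=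
  (A ⊆ L ∧ A.card = setSize P.τ inp.cls ∧ ∃ i, A = P.F inp.color inp.cls L i) ∧
    count S (fun w => P.Mid inp.cls w ∧ P.Bad A w) * (8 * 2 ^ inp.cls) ≤ count S (P.Mid inp.cls)

/-- The requirement on the selected color `y`, given the selected set `A`. Outneighbors that are bad for
`A` are ignored: `SetSpec` bounds their number. -/
def ColorSpec (inp : Msg) (A : Finset ℕ) (S : Multiset (ℕ → Msg)) (y : ℕ) : Prop :=
  y ∈ A ∧
    (count S (fun w => (P.Mid inp.cls w ∧ ¬ P.Bad A w) ∧ ∃ z ∈ setOf w, P.R y z) +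
      count S (fun w => inp.cls < (w 0).cls ∧ ∃ z ∈ P.finalOf w, P.R y z)) *
        (8 * 2 ^ inp.cls * P.τ) ≤ count S (P.Mid inp.cls) * P.τ + S.card * P.D

/-- The rule of the core algorithm. A node of class `c < H` sends its shrunken list in round `2 * c`, its
set in round `2 * c + 1` and its color in round `3 * H - c`; nodes of class `H` send their color in
round `2 * H`, before all others. -/
noncomputable def rule : Rule Msg Msg := fun t inp own S =>
  ⟨inp.color, inp.cls,
    if inp.cls < P.H then
      if t = 2 * inp.cls then pickSet (P.ListSpec inp S)
      else if t = 2 * inp.cls + 1 then pickSet (P.SetSpec inp (own (2 * inp.cls)).set S)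
      else if t = 3 * P.H - inp.cls then
        pickColor (P.ColorSpec inp (own (2 * inp.cls + 1)).set S)
      else ∅
    else if t = 3 * P.H - inp.cls then pickColor (· ∈ inp.set) else ∅⟩

/-- The color that a node has chosen, read off its messages. -/
def output (w : ℕ → Msg) : ℕ := (P.finalOf w).sup id

section Correctness

variable {V : Type*} [Fintype V] (G : Digraph V) (inp : V → Msg)

/-- The color that `v` has selected after `3 * H + 1` rounds. -/
noncomputable def result (v : V) : ℕ := P.output (hist G P.rule inp (3 * P.H + 1) v)

@[simp] theorem msg_color (t : ℕ) (v : V) : (msg G P.rule inp t v).color = (inp v).color := rfl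
@[simp] theorem msg_cls (t : ℕ) (v : V) : (msg G P.rule inp t v).cls = (inp v).cls := rfl

theorem hist_zero_cls {t : ℕ} (ht : 0 < t) (v : V) :
    (hist G P.rule inp t v 0).cls = (inp v).cls := by
  rw [hist_of_lt _ _ _ _ ht, msg_cls]

theorem hist_zero_color {t : ℕ} (ht : 0 < t) (v : V) :
    (hist G P.rule inp t v 0).color = (inp v).color := by
  rw [hist_of_lt _ _ _ _ ht, msg_color]

/-- The shrunken list of `v`. -/
noncomputable def nodeList (v : V) : Finset ℕ := (msg G P.rule inp (2 * (inp v).cls) v).set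

/-- The set that `v` selects. -/
noncomputable def nodeSet (v : V) : Finset ℕ := (msg G P.rule inp (2 * (inp v).cls + 1) v).set

/-- The singleton of the color that `v` selects. -/
noncomputable def nodeFinal (v : V) : Finset ℕ :=
  (msg G P.rule inp (3 * P.H - (inp v).cls) v).set

theorem listOf_hist {t : ℕ} {v : V} (ht : 2 * (inp v).cls < t) :
    listOf (hist G P.rule inp t v) = P.nodeList G inp v := by
  rw [listOf, hist_zero_cls _ _ _ (by omega), hist_of_lt _ _ _ _ ht, nodeList]

theorem setOf_hist {t : ℕ} {v : V} (ht : 2 * (inp v).cls + 1 < t) :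
    setOf (hist G P.rule inp t v) = P.nodeSet G inp v := by
  rw [setOf, hist_zero_cls _ _ _ (by omega), hist_of_lt _ _ _ _ ht, nodeSet]

theorem finalOf_hist {t : ℕ} {v : V} (ht : 3 * P.H - (inp v).cls < t) :
    P.finalOf (hist G P.rule inp t v) = P.nodeFinal G inp v := by
  rw [finalOf, hist_zero_cls _ _ _ (by omega), hist_of_lt _ _ _ _ ht, nodeFinal]

theorem nodeList_eq {v : V} (hv : (inp v).cls < P.H) : P.nodeList G inp v =
    pickSet (P.ListSpec (inp v)
      ((outNbrs G v).val.map (hist G P.rule inp (2 * (inp v).cls)))) := by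
  rw [nodeList, msg, rule]
  simp only [hv, if_true]

theorem nodeSet_eq {v : V} (hv : (inp v).cls < P.H) : P.nodeSet G inp v =
    pickSet (P.SetSpec (inp v) (P.nodeList G inp v)
      ((outNbrs G v).val.map (hist G P.rule inp (2 * (inp v).cls + 1)))) := by
  rw [nodeSet, msg, rule]
  simp only [hv, if_true]
  rw [if_neg (by omega), hist_of_lt _ _ _ _ (by omega), nodeList]

theorem nodeFinal_eq {v : V} (hv : (inp v).cls < P.H) : P.nodeFinal G inp v =
    pickColor (P.ColorSpec (inp v) (P.nodeSet G inp v)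
      ((outNbrs G v).val.map (hist G P.rule inp (3 * P.H - (inp v).cls)))) := by
  rw [nodeFinal, msg, rule]
  simp only [hv, if_true]
  rw [if_neg (by omega), if_neg (by omega), hist_of_lt _ _ _ _ (by omega), nodeSet]

theorem nodeFinal_eq_of_le {v : V} (hv : P.H ≤ (inp v).cls) : P.nodeFinal G inp v =
    pickColor (· ∈ (inp v).set) := by
  rw [nodeFinal, msg, rule]
  simp only [hv.not_gt, if_true, if_false]

theorem nodeList_subset (v : V) (hv : (inp v).cls < P.H) :
    P.nodeList G inp v ⊆ (inp v).set := by
  rw [nodeList_eq _ _ _ hv]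
  obtain h | h := pickSet_eq_empty_or (P.ListSpec (inp v)
      ((outNbrs G v).val.map (hist G P.rule inp (2 * (inp v).cls))))
  · rw [h]; exact Finset.empty_subset _
  · exact h.1

theorem nodeSet_subset (v : V) (hv : (inp v).cls < P.H) :
    P.nodeSet G inp v ⊆ P.nodeList G inp v ∧
      (P.nodeSet G inp v).card ≤ setSize P.τ (inp v).cls := by
  rw [nodeSet_eq _ _ _ hv]
  obtain h | h := pickSet_eq_empty_or (P.SetSpec (inp v) (P.nodeList G inp v)
      ((outNbrs G v).val.map (hist G P.rule inp (2 * (inp v).cls + 1))))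
  · rw [h]; exact ⟨Finset.empty_subset _, by simp⟩
  · exact ⟨h.1.1, h.1.2.1.le⟩

theorem nodeFinal_subset (v : V) (hv : (inp v).cls < P.H) :
    P.nodeFinal G inp v ⊆ P.nodeSet G inp v := by
  rw [nodeFinal_eq _ _ _ hv]
  obtain h | ⟨x, h, h'⟩ := pickColor_eq_empty_or (P.ColorSpec (inp v) (P.nodeSet G inp v)
      ((outNbrs G v).val.map (hist G P.rule inp (3 * P.H - (inp v).cls))))
  · rw [h]; exact Finset.empty_subset _
  · rw [h']; exact Finset.singleton_subset_iff.2 h.1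

theorem nodeFinal_eq_empty_or (v : V) :
    P.nodeFinal G inp v = ∅ ∨ ∃ x, P.nodeFinal G inp v = {x} := by
  obtain hv | hv := lt_or_ge (inp v).cls P.H
  · rw [nodeFinal_eq _ _ _ hv]
    exact (pickColor_eq_empty_or _).imp_right fun ⟨x, _, h⟩ => ⟨x, h⟩
  · rw [nodeFinal_eq_of_le _ _ _ hv]
    exact (pickColor_eq_empty_or _).imp_right fun ⟨x, _, h⟩ => ⟨x, h⟩

/-- Messages contain only colors of the list of the sender, whence the bound on their size. -/
theorem msg_set_subset (t : ℕ) (v : V) : (msg G P.rule inp t v).set ⊆ (inp v).set := by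
  by_cases hv : (inp v).cls < P.H
  · by_cases h1 : t = 2 * (inp v).cls
    · rw [h1]; exact P.nodeList_subset G inp v hv
    by_cases h2 : t = 2 * (inp v).cls + 1
    · rw [h2]; exact (P.nodeSet_subset G inp v hv).1.trans (P.nodeList_subset G inp v hv)
    by_cases h3 : t = 3 * P.H - (inp v).cls
    · rw [h3]
      exact (P.nodeFinal_subset G inp v hv).trans
        ((P.nodeSet_subset G inp v hv).1.trans (P.nodeList_subset G inp v hv))
    · rw [msg, rule]
      simp [hv, h1, h2, h3]
  · by_cases h3 : t = 3 * P.H - (inp v).cls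
    · rw [h3]
      change P.nodeFinal G inp v ⊆ _
      rw [P.nodeFinal_eq_of_le G inp (not_lt.1 hv)]
      obtain h | ⟨x, h, h'⟩ := pickColor_eq_empty_or (· ∈ (inp v).set)
      · rw [h]; exact Finset.empty_subset _
      · rw [h']; exact Finset.singleton_subset_iff.2 h
    · rw [msg, rule]
      simp [hv, h3]

end Correctness

end Core

end CoreAlgorithm

/-! ### Correctness of the core algorithm -/

namespace Core

variable (P : Core) {V : Type*} [Fintype V] (G : Digraph V) (inp : V → Msg)

/-- The inputs for which the core algorithm works. -/
structure Admissible : Prop where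
  proper : ∀ u v, G.Adj u v → (inp u).color ≠ (inp v).color
  color_lt : ∀ v, (inp v).color < P.m
  list_subset : ∀ v, (inp v).set ⊆ P.X
  list_card : ∀ v, (inp v).cls < P.H → 2 * listSize P.D P.τ (inp v).cls ≤ (inp v).set.card
  nonempty : ∀ v, (inp v).set.Nonempty

variable {P G inp}

theorem setSize_pos (hP : P.Valid) (c : ℕ) : 0 < setSize P.τ c := by
  have := hP.τ_pos
  unfold setSize
  positivity

theorem mem_outNbrs {u v : V} : u ∈ outNbrs G v ↔ G.Adj v u := by
  simp [outNbrs]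

theorem Low_hist_iff {u : V} {c x : ℕ} :
    P.Low c x (hist G P.rule inp (2 * c) u) ↔
      (inp u).cls + P.g < c ∧ ∃ z ∈ P.nodeSet G inp u, P.R x z := by
  obtain rfl | hc := Nat.eq_zero_or_pos c
  · simp [Low]
  · rw [Low, hist_zero_cls _ _ _ (by omega)]
    refine and_congr_right fun h => ?_
    rw [setOf_hist _ _ _ (by omega)]

theorem Mid_hist_iff {u : V} {c t : ℕ} (ht : 0 < t) :
    P.Mid c (hist G P.rule inp t u) ↔ (inp u).cls ≤ c ∧ c ≤ (inp u).cls + P.g := by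
  rw [Mid, hist_zero_cls _ _ _ ht]

theorem Bad_hist_iff {u : V} {A : Finset ℕ} {t : ℕ} (ht : 2 * (inp u).cls < t) :
    P.Bad A (hist G P.rule inp t u) ↔
      ∃ j, Conflict P.R P.τ A (P.F (inp u).color (inp u).cls (P.nodeList G inp u) j) := by
  rw [Bad, hist_zero_cls _ _ _ (by omega), hist_zero_color _ _ _ (by omega), listOf_hist _ _ _ ht]

/-- At most half of the list is lost: on average a color of the list is related to the sets of few
much smaller outneighbors, since these sets are small. -/
theorem nodeList_spec (hP : P.Valid) (hI : P.Admissible G inp) {v : V}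
    (hv : (inp v).cls < P.H) :
    P.ListSpec (inp v) ((outNbrs G v).val.map (hist G P.rule inp (2 * (inp v).cls)))
      (P.nodeList G inp v) := by
  classical
  rw [nodeList_eq _ _ _ hv]
  apply pickSet_spec
  set c := (inp v).cls with hc
  have hk := setSize_pos hP c
  have hD := hP.D_pos
  have hsum : ∑ x ∈ (inp v).set, ((outNbrs G v).filter fun u =>
      (inp u).cls + P.g < c ∧ ∃ z ∈ P.nodeSet G inp u, P.R x z).card * 2 ^ P.g
      ≤ (outNbrs G v).card * (setSize P.τ c * P.D) := by
    obtain hg | hg := lt_or_ge c P.g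
    · rw [Finset.sum_eq_zero]
      · exact Nat.zero_le _
      · intro x _
        rw [Finset.filter_false_of_mem, Finset.card_empty, zero_mul]
        intro u _ h
        omega
    · rw [← Finset.sum_mul]
      have h1 := sum_card_filter_le (inp v).set (outNbrs G v)
        (fun x u => (inp u).cls + P.g < c ∧ ∃ z ∈ P.nodeSet G inp u, P.R x z)
        (setSize P.τ (c - P.g) * P.D) (by
          intro u _
          by_cases hu : (inp u).cls + P.g < c
          · simp only [hu, true_and]
            rw [← natCard_mem_and]
            refine (card_related_le hP.card_related (hI.list_subset v)).trans ?_
            refine Nat.mul_le_mul_right _ (((P.nodeSet_subset G inp u (by omega)).2).trans ?_)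
            unfold setSize
            have : (inp u).cls ≤ c - P.g := by omega
            gcongr
            norm_num
          · simp [hu])
      refine le_trans (le_of_eq ?_) ((Nat.mul_le_mul_right (2 ^ P.g) h1).trans (le_of_eq ?_))
      · congr!
      have : (2 : ℕ) ^ c = 2 ^ (c - P.g) * 2 ^ P.g := by
        rw [← pow_add, Nat.sub_add_cancel hg]
      unfold setSize
      rw [this]
      ring
  obtain ⟨L, hL, hcard, hx⟩ := exists_subset_mul_le _ _ _ _ (hI.list_card v hv) hsum
  refine ⟨L, hL, hcard, fun x hxL => ?_⟩
  rw [count_map, Multiset.card_map, Finset.card_val]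
  have h2 := hx x hxL
  have e : ((outNbrs G v).filter fun u => P.Low c x (hist G P.rule inp (2 * c) u)).card =
      ((outNbrs G v).filter fun u =>
        (inp u).cls + P.g < c ∧ ∃ z ∈ P.nodeSet G inp u, P.R x z).card :=
    congrArg Finset.card (Finset.filter_congr fun u _ => Low_hist_iff)
  rw [← hc]
  refine le_trans (Nat.mul_le_mul_right _ ((le_of_eq (by congr!)).trans e.le)) ?_
  refine Nat.le_of_mul_le_mul_right (c := setSize P.τ c * P.D) ?_ (by positivity)
  refine le_trans (le_of_eq ?_) h2
  unfold listSize blockSize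
  rw [← hc]
  ring

theorem nodeList_valid (hP : P.Valid) (hI : P.Admissible G inp) {v : V}
    (hv : (inp v).cls < P.H) :
    P.nodeList G inp v ⊆ P.X ∧ (P.nodeList G inp v).card = listSize P.D P.τ (inp v).cls :=
  ⟨(nodeList_spec hP hI hv).1.trans (hI.list_subset v), (nodeList_spec hP hI hv).2.1⟩

/-- Every outneighbor of similar class excludes at most `q` candidate sets, so some candidate set is in
conflict with at most a `1 / (8 * 2 ^ H)` fraction of these outneighbors. -/
theorem nodeSet_spec (hP : P.Valid) (hI : P.Admissible G inp) {v : V}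
    (hv : (inp v).cls < P.H) :
    P.SetSpec (inp v) (P.nodeList G inp v)
      ((outNbrs G v).val.map (hist G P.rule inp (2 * (inp v).cls + 1)))
      (P.nodeSet G inp v) := by
  classical
  rw [nodeSet_eq _ _ _ hv]
  apply pickSet_spec
  set c := (inp v).cls with hc
  obtain ⟨hLX, hLc⟩ := nodeList_valid hP hI hv
  have hq := hP.q_pos
  set S := (outNbrs G v).val.map (hist G P.rule inp (2 * c + 1))
  let K : Fin (8 * 2 ^ P.H * P.q) → Finset ℕ := P.F (inp v).color c (P.nodeList G inp v)
  have hsum : ∑ i, count S (fun w => P.Mid c w ∧ P.Bad (K i) w) ≤ count S (P.Mid c) * P.q := by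
    simp only [S, count_map]
    have := sum_card_filter_le (univ : Finset (Fin (8 * 2 ^ P.H * P.q)))
      ((outNbrs G v).filter fun u => P.Mid c (hist G P.rule inp (2 * c + 1) u))
      (fun i u => P.Bad (K i) (hist G P.rule inp (2 * c + 1) u)) P.q (by
        intro u hu
        rw [Finset.mem_filter, mem_outNbrs, Mid_hist_iff (by omega)] at hu
        obtain ⟨hadj, huc, -⟩ := hu
        simp_rw [Bad_hist_iff (P := P) (G := G) (inp := inp) (u := u) (t := 2 * c + 1) (by omega)]
        obtain ⟨hLX', hLc'⟩ := nodeList_valid hP hI (v := u) (by omega)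
        refine le_trans (le_of_eq ?_) (hP.conflict _ _ _ (hI.color_lt v) hv hLX hLc _ _ _
          (hI.color_lt u) huc hLX' hLc' (hI.proper _ _ hadj))
        rw [Nat.card_eq_fintype_card, Fintype.card_subtype])
    refine le_trans (le_of_eq ?_) this
    refine Finset.sum_congr rfl fun i _ => ?_
    rw [Finset.filter_filter]
    congr!
  have hne : (univ : Finset (Fin (8 * 2 ^ P.H * P.q))).Nonempty := by
    have : NeZero (8 * 2 ^ P.H * P.q) := ⟨by positivity⟩
    exact Finset.univ_nonempty
  obtain ⟨i, -, hi⟩ := exists_mul_card_le_sum _ hne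
    (fun i => count S (fun w => P.Mid c w ∧ P.Bad (K i) w))
  have hF := hP.family _ _ _ (hI.color_lt v) hv hLX hLc i
  refine ⟨K i, ⟨hF.1, hF.2, i, rfl⟩, ?_⟩
  rw [← hc]
  have h1 := hi.trans hsum
  rw [Finset.card_univ, Fintype.card_fin, ← mul_assoc] at h1
  refine le_trans ?_ (Nat.le_of_mul_le_mul_right h1 hq)
  gcongr
  norm_num

/-- On average over the selected set, a color is subject to few conflicts: an outneighbor of similar
class that is not bad concerns fewer than `τ` colors of the set, and an outneighbor of larger class,
whose color is known, at most `D`. -/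
theorem nodeFinal_spec (hP : P.Valid) (hI : P.Admissible G inp) {v : V}
    (hv : (inp v).cls < P.H) :
    ∃ y, P.ColorSpec (inp v) (P.nodeSet G inp v)
      ((outNbrs G v).val.map (hist G P.rule inp (3 * P.H - (inp v).cls))) y ∧
      P.nodeFinal G inp v = {y} := by
  classical
  rw [nodeFinal_eq _ _ _ hv]
  apply pickColor_spec
  set c := (inp v).cls with hc
  obtain ⟨⟨hsub, hcard, -⟩, -⟩ := nodeSet_spec hP hI hv
  set A := P.nodeSet G inp v
  have hAX : A ⊆ P.X := hsub.trans (nodeList_valid hP hI hv).1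
  have hk := setSize_pos hP c
  set S := (outNbrs G v).val.map (hist G P.rule inp (3 * P.H - c))
  have h1 : ∑ y ∈ A, count S (fun w => (P.Mid c w ∧ ¬ P.Bad A w) ∧ ∃ z ∈ setOf w, P.R y z)
      ≤ count S (P.Mid c) * P.τ := by
    simp only [S, count_map]
    have := sum_card_filter_le A
      ((outNbrs G v).filter fun u => P.Mid c (hist G P.rule inp (3 * P.H - c) u) ∧
        ¬ P.Bad A (hist G P.rule inp (3 * P.H - c) u))
      (fun y u => ∃ z ∈ setOf (hist G P.rule inp (3 * P.H - c) u), P.R y z) P.τ (by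
        intro u hu
        rw [Finset.mem_filter, Mid_hist_iff (by omega)] at hu
        obtain ⟨-, ⟨huc, -⟩, hbad⟩ := hu
        rw [Bad_hist_iff (by omega)] at hbad
        rw [setOf_hist _ _ _ (by omega)]
        obtain ⟨⟨-, -, j, hj⟩, -⟩ := nodeSet_spec hP hI (v := u) (by omega)
        have : ¬ Conflict P.R P.τ A (P.nodeSet G inp u) := fun h => hbad ⟨j, hj ▸ h⟩
        rw [← natCard_mem_and]
        exact (not_le.1 this).le)
    refine le_trans (le_of_eq ?_) (this.trans (Nat.mul_le_mul_right _ ?_))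
    · refine Finset.sum_congr rfl fun i _ => ?_
      rw [Finset.filter_filter]
      congr!
    · exact Finset.card_le_card (Finset.monotone_filter_right _ fun u _ h => h.1)
  have h2 : ∑ y ∈ A, count S (fun w => c < (w 0).cls ∧ ∃ z ∈ P.finalOf w, P.R y z)
      ≤ S.card * P.D := by
    simp only [S, count_map, Multiset.card_map, Finset.card_val]
    refine sum_card_filter_le A (outNbrs G v) (fun y u =>
      c < (hist G P.rule inp (3 * P.H - c) u 0).cls ∧
        ∃ z ∈ P.finalOf (hist G P.rule inp (3 * P.H - c) u), P.R y z) P.D ?_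
    intro u _
    rw [hist_zero_cls _ _ _ (by omega)]
    by_cases hu : c < (inp u).cls
    · simp only [hu, true_and]
      rw [finalOf_hist _ _ _ (by omega), ← natCard_mem_and]
      refine (card_related_le hP.card_related hAX).trans ?_
      obtain h | ⟨x, h⟩ := P.nodeFinal_eq_empty_or G inp u
      · simp [h]
      · simp [h]
    · simp [hu]
  have hne : A.Nonempty := Finset.card_pos.1 (by rw [hcard]; exact hk)
  obtain ⟨y, hy, hle⟩ := exists_mul_card_le_sum A hne (fun y =>
    count S (fun w => (P.Mid c w ∧ ¬ P.Bad A w) ∧ ∃ z ∈ setOf w, P.R y z) +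
      count S (fun w => c < (w 0).cls ∧ ∃ z ∈ P.finalOf w, P.R y z))
  refine ⟨y, hy, ?_⟩
  rw [Finset.sum_add_distrib, hcard] at hle
  exact hle.trans (add_le_add h1 h2)

theorem nodeFinal_eq_result (hP : P.Valid) (hI : P.Admissible G inp) (v : V) :
    P.nodeFinal G inp v = {P.result G inp v} := by
  have h : ∃ y, P.nodeFinal G inp v = {y} := by
    obtain hv | hv := lt_or_ge (inp v).cls P.H
    · obtain ⟨y, -, h⟩ := nodeFinal_spec hP hI hv
      exact ⟨y, h⟩
    · rw [nodeFinal_eq_of_le _ _ _ hv]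
      obtain ⟨x, -, h⟩ := pickColor_spec (p := (· ∈ (inp v).set)) (hI.nonempty v)
      exact ⟨x, h⟩
  obtain ⟨y, h⟩ := h
  rw [h, result, output, finalOf_hist _ _ _ (by omega), h, Finset.sup_singleton]
  rfl

theorem result_mem (hP : P.Valid) (hI : P.Admissible G inp) (v : V) :
    P.result G inp v ∈ (inp v).set := by
  have : P.result G inp v ∈ P.nodeFinal G inp v := by
    rw [nodeFinal_eq_result hP hI]; exact Finset.mem_singleton_self _
  exact P.msg_set_subset G inp _ v this

open Classical in
/-- The guarantee of the core algorithm: bound on the number of outneighbors whose color is related to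
that of `v`. The first summand counts the outneighbors of similar class; the others account for those
of much smaller and of larger class. -/
theorem card_related_result_le (hP : P.Valid) (hI : P.Admissible G inp) {v : V}
    (hv : (inp v).cls < P.H) :
    (2 : ℝ) ^ (inp v).cls *
        ((outNbrs G v).filter fun u => P.R (P.result G inp v) (P.result G inp u)).card ≤
      ((outNbrs G v).filter fun u =>
          (inp u).cls ≤ (inp v).cls ∧ (inp v).cls ≤ (inp u).cls + P.g).card / 4 +
        (outNbrs G v).card / (64 * 2 ^ P.g) + (outNbrs G v).card * P.D / (8 * P.τ) := by
  set c := (inp v).cls with hc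
  obtain ⟨y, hy, hfin⟩ := nodeFinal_spec hP hI hv
  rw [nodeFinal_eq_result hP hI, Finset.singleton_inj] at hfin
  rw [← hfin] at hy
  set φ := P.result G inp
  obtain ⟨hyA, hcol⟩ := hy
  obtain ⟨⟨hsub, hcard, -⟩, hbad⟩ := nodeSet_spec hP hI hv
  obtain ⟨-, -, hlow⟩ := nodeList_spec hP hI hv
  have hlow := hlow _ (hsub hyA)
  set A := P.nodeSet G inp v
  have hφ : ∀ u, (inp u).cls < P.H → φ u ∈ P.nodeSet G inp u := by
    intro u hu
    refine P.nodeFinal_subset G inp u hu ?_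
    rw [nodeFinal_eq_result hP hI]
    exact Finset.mem_singleton_self _
  set out := outNbrs G v
  simp only [count_map, Multiset.card_map, Finset.card_val, ← hc] at hlow hbad hcol
  have hmid1 : (out.filter fun u => P.Mid c (hist G P.rule inp (2 * c + 1) u)) =
      out.filter fun u => (inp u).cls ≤ c ∧ c ≤ (inp u).cls + P.g :=
    Finset.filter_congr fun u _ => Mid_hist_iff (by omega)
  have hmid2 : (out.filter fun u => P.Mid c (hist G P.rule inp (3 * P.H - c) u)) =
      out.filter fun u => (inp u).cls ≤ c ∧ c ≤ (inp u).cls + P.g :=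
    Finset.filter_congr fun u _ => Mid_hist_iff (by omega)
  rw [hmid1] at hbad
  rw [hmid2] at hcol
  -- `M` counts the outneighbors of similar class; `n₁`, ..., `n₄` count those that cause conflicts and
  -- have much smaller class, are bad, are of similar class but not bad, and have larger class.
  set M := (out.filter fun u => (inp u).cls ≤ c ∧ c ≤ (inp u).cls + P.g).card
  set n₁ := (out.filter fun u => P.Low c (φ v) (hist G P.rule inp (2 * c) u)).card
  set n₂ := (out.filter fun u => P.Mid c (hist G P.rule inp (2 * c + 1) u) ∧
    P.Bad A (hist G P.rule inp (2 * c + 1) u)).card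
  set n₃ := (out.filter fun u => (P.Mid c (hist G P.rule inp (3 * P.H - c) u) ∧
    ¬ P.Bad A (hist G P.rule inp (3 * P.H - c) u)) ∧
      ∃ z ∈ setOf (hist G P.rule inp (3 * P.H - c) u), P.R (φ v) z).card
  set n₄ := (out.filter fun u => c < (hist G P.rule inp (3 * P.H - c) u 0).cls ∧
    ∃ z ∈ P.finalOf (hist G P.rule inp (3 * P.H - c) u), P.R (φ v) z).card
  have htotal : (out.filter fun u => P.R (φ v) (φ u)).card ≤ n₁ + n₂ + n₃ + n₄ := by
    refine le_trans (Finset.card_le_card ?_) ((Finset.card_union_le _ _).trans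
      (add_le_add_left ((Finset.card_union_le _ _).trans
        (add_le_add_left (Finset.card_union_le _ _) _)) _))
    intro u hu
    obtain ⟨huo, hR⟩ := Finset.mem_filter.1 hu
    simp only [Finset.mem_union, Finset.mem_filter, huo, true_and]
    obtain hcu | hcu := lt_or_ge c (inp u).cls
    · right
      rw [hist_zero_cls _ _ _ (by omega), finalOf_hist _ _ _ (by omega),
        nodeFinal_eq_result hP hI]
      exact ⟨hcu, _, Finset.mem_singleton_self _, hR⟩
    left
    obtain hg | hg := lt_or_ge ((inp u).cls + P.g) c
    · left; left
      rw [Low_hist_iff]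
      exact ⟨hg, _, hφ u (by omega), hR⟩
    by_cases hb : ∃ j, Conflict P.R P.τ A
        (P.F (inp u).color (inp u).cls (P.nodeList G inp u) j)
    · left; right
      rw [Mid_hist_iff (by omega), Bad_hist_iff (by omega)]
      exact ⟨⟨hcu, hg⟩, hb⟩
    · right
      rw [Mid_hist_iff (by omega), Bad_hist_iff (by omega), setOf_hist _ _ _ (by omega)]
      exact ⟨⟨⟨hcu, hg⟩, hb⟩, _, hφ u (by omega), hR⟩
  have hτ : (0 : ℝ) < P.τ := by exact_mod_cast hP.τ_pos
  have h1 : (2 : ℝ) ^ c * n₁ ≤ out.card / (64 * 2 ^ P.g) := by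
    rw [le_div_iff₀ (by positivity)]
    have : (n₁ : ℝ) * (64 * 2 ^ c * 2 ^ P.g) ≤ out.card := by exact_mod_cast hlow
    linarith
  have h2 : (2 : ℝ) ^ c * n₂ ≤ M / 8 := by
    have : (n₂ : ℝ) * (8 * 2 ^ c) ≤ M := by
      have : n₂ * (8 * 2 ^ c) ≤ M := by convert hbad
      exact_mod_cast this
    linarith
  have h3 : (2 : ℝ) ^ c * (n₃ + n₄) ≤ M / 8 + out.card * P.D / (8 * P.τ) := by
    have h : ((n₃ : ℝ) + n₄) * (8 * 2 ^ c * P.τ) ≤ M * P.τ + out.card * P.D := by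
      have : (n₃ + n₄) * (8 * 2 ^ c * P.τ) ≤ M * P.τ + out.card * P.D := by convert hcol
      exact_mod_cast this
    have : (M : ℝ) / 8 + out.card * P.D / (8 * P.τ) = (M * P.τ + out.card * P.D) / (8 * P.τ) := by
      field_simp
    rw [this, le_div_iff₀ (by positivity)]
    linarith
  have h4 : ((out.filter fun u => P.R (φ v) (φ u)).card : ℝ) ≤ n₁ + n₂ + n₃ + n₄ := by
    exact_mod_cast htotal
  have h5 : (2 : ℝ) ^ c * (out.filter fun u => P.R (φ v) (φ u)).card
      ≤ 2 ^ c * (n₁ + n₂ + n₃ + n₄) := by gcongr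
  linarith

end Core

/-! ### Encoding messages -/

section Encoding

/-- Ranking the elements by `f`, with ties broken arbitrarily. -/
theorem exists_rank {α : Type*} [Fintype α] (f : α → ℕ) :
    ∃ r : α → ℕ, Function.Injective r ∧ ∀ a, r a < (univ.filter fun b => f b ≤ f a).card := by
  classical
  let key : α → ℕ ×ₗ Fin (Fintype.card α) := fun a => toLex (f a, Fintype.equivFin α a)
  have hkey : Function.Injective key := fun a b h =>
    (Fintype.equivFin α).injective (congrArg (fun x => (ofLex x).2) h)
  have hmono : ∀ a b, key a < key b →
      (univ.filter fun x => key x < key a).card < (univ.filter fun x => key x < key b).card := by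
    intro a b hab
    refine Finset.card_lt_card (Finset.ssubset_iff_of_subset (fun x hx => ?_) |>.2 ⟨a, ?_, ?_⟩)
    · simp only [Finset.mem_filter, Finset.mem_univ, true_and] at hx ⊢
      exact hx.trans hab
    · simpa using hab
    · simp
  refine ⟨fun a => (univ.filter fun x => key x < key a).card, fun a b h => ?_, fun a => ?_⟩
  · by_contra hne
    obtain h' | h' := lt_or_gt_of_ne (hkey.ne hne)
    · exact (hmono a b h').ne h
    · exact (hmono b a h').ne' h
  · refine Finset.card_lt_card (Finset.ssubset_iff_of_subset (fun x hx => ?_) |>.2 ⟨a, ?_, ?_⟩)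
    · simp only [Finset.mem_filter, Finset.mem_univ, true_and] at hx ⊢
      rw [Prod.Lex.lt_iff] at hx
      exact hx.elim le_of_lt fun h => h.1.le
    · simp
    · simp

theorem card_powerset_filter_card_le (X : Finset ℕ) (k : ℕ) :
    (X.powerset.filter fun S => S.card ≤ k).card ≤ (X.card + 1) ^ k := by
  have hsub : (X.powerset.filter fun S => S.card ≤ k) ⊆
      (range (k + 1)).biUnion fun j => X.powersetCard j := by
    intro S hS
    rw [Finset.mem_filter, Finset.mem_powerset] at hS
    simp only [Finset.mem_biUnion, Finset.mem_range, Finset.mem_powersetCard]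
    exact ⟨S.card, by omega, hS.1, rfl⟩
  refine (Finset.card_le_card hsub).trans (Finset.card_biUnion_le.trans ?_)
  rw [add_pow]
  refine Finset.sum_le_sum fun j hj => ?_
  rw [Finset.card_powersetCard, one_pow, mul_one]
  have h1 : 0 < k.choose j := Nat.choose_pos (by rw [Finset.mem_range] at hj; omega)
  calc X.card.choose j ≤ X.card ^ j := Nat.choose_le_pow _ _
    _ ≤ _ := Nat.le_mul_of_pos_right _ h1

instance : Countable Msg :=
  Function.Injective.countable (f := fun x : Msg => (x.color, x.cls, x.set)) fun x y h => by
    cases x; cases y; simp_all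

/-- An injective encoding of messages by numbers, of small binary length on the messages that occur. A
set of colors is encoded by its rank among the subsets of `X`, ordered by cardinality; the other
messages are encoded by odd numbers. -/
theorem exists_encoding (X : Finset ℕ) (m H : ℕ) :
    ∃ enc : Msg → ℕ, Function.Injective enc ∧
      ∀ x : Msg, x.color < m → x.cls ≤ H → x.set ⊆ X →
        Nat.size (enc x) ≤ 1 + Nat.size m + Nat.size (H + 1) +
          min X.card (x.set.card * Nat.size X.card) := by
  classical
  obtain ⟨r, hr, hlt⟩ := exists_rank (fun S : {S // S ∈ X.powerset} => S.1.card)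
  obtain ⟨e, he⟩ := exists_injective_nat Msg
  let ok : Msg → Prop := fun x => x.color < m ∧ x.cls ≤ H ∧ x.set ∈ X.powerset
  let rk : Msg → ℕ := fun x => if h : x.set ∈ X.powerset then r ⟨x.set, h⟩ else 0
  let enc : Msg → ℕ := fun x =>
    if ok x then 2 * (x.color + m * (x.cls + (H + 1) * rk x)) else 2 * e x + 1
  refine ⟨enc, fun x y hxy => ?_, fun x h1 h2 h3 => ?_⟩
  · simp only [enc] at hxy
    split_ifs at hxy with hx hy hy
    · obtain ⟨hx1, hx2, hx3⟩ := hx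
      obtain ⟨hy1, hy2, hy3⟩ := hy
      have h : x.color + m * (x.cls + (H + 1) * rk x) = y.color + m * (y.cls + (H + 1) * rk y) := by
        omega
      have hc : x.color = y.color := by
        have := congrArg (· % m) h
        simpa [Nat.add_mul_mod_self_left, Nat.mod_eq_of_lt hx1, Nat.mod_eq_of_lt hy1] using this
      rw [hc] at h
      have h' : x.cls + (H + 1) * rk x = y.cls + (H + 1) * rk y :=
        Nat.eq_of_mul_eq_mul_left (by omega) (Nat.add_left_cancel h)
      have hl : x.cls = y.cls := by
        have := congrArg (· % (H + 1)) h'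
        simpa [Nat.add_mul_mod_self_left, Nat.mod_eq_of_lt (Nat.lt_succ_of_le hx2),
          Nat.mod_eq_of_lt (Nat.lt_succ_of_le hy2)] using this
      rw [hl] at h'
      have hk : rk x = rk y := Nat.eq_of_mul_eq_mul_left (Nat.succ_pos H) (Nat.add_left_cancel h')
      simp only [rk, dif_pos hx3, dif_pos hy3] at hk
      have hs := congrArg Subtype.val (hr hk)
      cases x; cases y; simp_all
    · omega
    · omega
    · exact he (by omega)
  · have hok : ok x := ⟨h1, h2, Finset.mem_powerset.2 h3⟩
    have h4 : rk x < 2 ^ min X.card (x.set.card * Nat.size X.card) := by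
      have h5 : rk x < (X.powerset.filter fun S => S.card ≤ x.set.card).card := by
        simp only [rk, dif_pos hok.2.2]
        refine (hlt ⟨x.set, hok.2.2⟩).trans_le ?_
        refine Finset.card_le_card_of_injOn (fun S => S.1) (fun S hS => ?_)
          (fun S _ S' _ h => Subtype.ext h)
        simp only [Finset.coe_filter, Finset.mem_univ, true_and, Set.mem_ofPred_eq] at hS ⊢
        exact ⟨S.2, hS⟩
      rcases min_cases X.card (x.set.card * Nat.size X.card) with ⟨h, -⟩ | ⟨h, -⟩
      · rw [h, ← Finset.card_powerset]
        exact h5.trans_le (Finset.card_le_card (Finset.filter_subset _ _))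
      · rw [h, mul_comm, pow_mul]
        refine h5.trans_le ((card_powerset_filter_card_le X _).trans ?_)
        exact Nat.pow_le_pow_left (Nat.lt_size_self _) _
    rw [Nat.size_le]
    simp only [enc, if_pos hok]
    have hm := Nat.lt_size_self m
    have hH := Nat.lt_size_self (H + 1)
    set B := min X.card (x.set.card * Nat.size X.card)
    have h6 : x.cls + (H + 1) * rk x < (H + 1) * 2 ^ B := by
      calc x.cls + (H + 1) * rk x < (H + 1) * (rk x + 1) := by rw [mul_add]; omega
        _ ≤ _ := Nat.mul_le_mul_left _ h4
    have h7 : x.color + m * (x.cls + (H + 1) * rk x) < m * ((H + 1) * 2 ^ B) := by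
      calc _ < m * (x.cls + (H + 1) * rk x + 1) := by rw [mul_add m _ 1]; omega
        _ ≤ _ := Nat.mul_le_mul_left _ h6
    calc _ < 2 * (m * ((H + 1) * 2 ^ B)) := by omega
      _ ≤ 2 * (2 ^ Nat.size m * (2 ^ Nat.size (H + 1) * 2 ^ B)) := by gcongr
      _ = _ := by rw [pow_add, pow_add, pow_add]; ring

end Encoding

/-! ### The choice of the threshold -/

section Parameters

/-- The threshold `τ` for `n` colors, `m` initial colors, `H` classes and a relation of degree `D`.
`Nat.size` is the binary length. -/
def threshold (n m H D : ℕ) : ℕ :=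
  64 + 8 * (H + Nat.size (Nat.size m) + Nat.size (Nat.size n) + Nat.size D)

/-- The number of triples of initial color, class and list is at most `2 ^ E` with `E` of order
`log m + τ * D * 4 ^ H * log |X|`, so that `q = 2 * E + 1` and `τ` of the order of `H + log E`
suffice. -/
theorem exists_valid_core (X : Finset ℕ) (m H g D : ℕ) (R : ℕ → ℕ → Prop) (hD : 0 < D)
    (hR : ∀ y, Nat.card {x // x ∈ X ∧ R x y} ≤ D) :
    ∃ q F, Core.Valid ⟨X, m, H, g, threshold X.card m H D, q, D, R, F⟩ := by
  set τ := threshold X.card m H D with hτ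
  set a := Nat.size (Nat.size m)
  set b := Nat.size (Nat.size X.card)
  set d := Nat.size D
  set A := H + a + b + d with hA
  have hτA : τ = 64 + 8 * A := hτ
  set E := H + Nat.size m + Nat.size X.card * listSize D τ H with hE
  have hm : Nat.size m < 2 ^ a := Nat.lt_size_self _
  have hX : Nat.size X.card < 2 ^ b := Nat.lt_size_self _
  have hDd : D < 2 ^ d := Nat.lt_size_self _
  have hH : H < 2 ^ H := Nat.lt_two_pow_self
  have hτ2 : τ ≤ 2 ^ (6 + A) := by
    have : A + 1 ≤ 2 ^ A := Nat.lt_two_pow_self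
    rw [pow_add]
    omega
  have hℓ : Nat.size X.card * listSize D τ H ≤ 2 ^ (15 + 3 * A) := by
    calc Nat.size X.card * listSize D τ H
        ≤ 2 ^ b * (8 * 2 ^ H * 2 ^ (6 + A) * (64 * 2 ^ d * 2 ^ H)) := by
          unfold listSize setSize blockSize
          gcongr
      _ = 2 ^ (b + (3 + H + (6 + A) + (6 + d + H))) := by
          simp only [pow_add]
          norm_num
      _ ≤ _ := Nat.pow_le_pow_right (by norm_num) (by omega)
  have hEle : 2 * E + 1 ≤ 2 ^ (19 + 3 * A) := by
    have h1 : 2 ^ H ≤ 2 ^ (15 + 3 * A) := Nat.pow_le_pow_right (by norm_num) (by omega)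
    have h2 : 2 ^ a ≤ 2 ^ (15 + 3 * A) := Nat.pow_le_pow_right (by norm_num) (by omega)
    have h3 : 2 ^ (19 + 3 * A) = 16 * 2 ^ (15 + 3 * A) := by
      rw [show 19 + 3 * A = 4 + (15 + 3 * A) by ring, pow_add]
      norm_num
    omega
  have hfam := exists_families X m H τ (2 * E + 1) D R hD hR (by
      have h1 : H * (m * (X.card + 1) ^ listSize D τ H) ≤ 2 ^ E := by
        calc _ ≤ 2 ^ H * (2 ^ Nat.size m * (2 ^ Nat.size X.card) ^ listSize D τ H) := by
              gcongr
              · exact (Nat.lt_size_self m).le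
              · exact Nat.lt_size_self _
          _ = _ := by rw [← pow_mul, ← pow_add, ← pow_add, hE, ← add_assoc]
      calc _ ≤ (2 ^ E) ^ 2 := Nat.pow_le_pow_left h1 2
        _ = 2 ^ (2 * E) := by rw [← pow_mul, mul_comm]
        _ < _ := Nat.pow_lt_pow_right (by norm_num) (Nat.lt_succ_self _)) (by
      calc 512 * 4 ^ H * (2 * E + 1) ≤ 512 * 4 ^ H * 2 ^ (19 + 3 * A) := by gcongr
        _ = 2 ^ (9 + 2 * H + (19 + 3 * A)) := by
            rw [show (4 : ℕ) = 2 ^ 2 from rfl, show (512 : ℕ) = 2 ^ 9 from rfl, ← pow_mul,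
              ← pow_add, ← pow_add]
        _ ≤ _ := Nat.pow_le_pow_right (by norm_num) (by omega))
  obtain ⟨F, hF1, hF2⟩ := hfam
  exact ⟨2 * E + 1, F, ⟨hD, by rw [hτA]; simp, by simp, hR, hF1, hF2⟩⟩

end Parameters

/-! ### Logarithms -/

section Logarithms

theorem one_le_lg (x : ℝ) : 1 ≤ lg x := le_max_left _ _

theorem lg_mono {x y : ℝ} (hx : 0 < x) (h : x ≤ y) : lg x ≤ lg y :=
  max_le_max le_rfl (Real.logb_le_logb_of_le (by norm_num) hx h)

theorem lg_two_mul_le {x : ℝ} (hx : 0 < x) : lg (2 * x) ≤ lg x + 1 := by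
  unfold lg
  rw [Real.logb_mul (by norm_num) hx.ne', Real.logb_self_eq_one (by norm_num)]
  refine max_le ?_ ?_
  · linarith [le_max_left 1 (Real.logb 2 x)]
  · linarith [le_max_right 1 (Real.logb 2 x)]

theorem natLog_le_lg (n : ℕ) : (Nat.log 2 n : ℝ) ≤ lg n := by
  rcases Nat.eq_zero_or_pos n with rfl | hn
  · simp only [Nat.log_zero_right, Nat.cast_zero]
    linarith [one_le_lg 0]
  · refine le_trans ?_ (le_max_right _ _)
    rw [Real.le_logb_iff_rpow_le (by norm_num) (by exact_mod_cast hn), Real.rpow_natCast]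
    exact_mod_cast Nat.pow_log_le_self 2 hn.ne'

theorem size_le_lg_add_one (n : ℕ) : (Nat.size n : ℝ) ≤ lg n + 1 := by
  have h : Nat.size n ≤ Nat.log 2 n + 1 := Nat.size_le.2 (Nat.lt_pow_succ_log_self (by norm_num) n)
  have h' : (Nat.size n : ℝ) ≤ Nat.log 2 n + 1 := by exact_mod_cast h
  linarith [natLog_le_lg n]

theorem size_le_lg_of_le {n : ℕ} {x : ℝ} (hx : 1 ≤ x) (hn : (n : ℝ) ≤ 2 * x) :
    (Nat.size n : ℝ) ≤ lg x + 2 := by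
  rcases Nat.eq_zero_or_pos n with rfl | h0
  · simp only [Nat.size_zero, Nat.cast_zero]
    linarith [one_le_lg x]
  · have h0' : (0 : ℝ) < n := by exact_mod_cast h0
    have := (lg_mono h0' hn).trans (lg_two_mul_le (by linarith))
    linarith [size_le_lg_add_one n]

theorem size_size_le (n : ℕ) : (Nat.size (Nat.size n) : ℝ) ≤ 3 * lg (lg n) := by
  have := size_le_lg_of_le (one_le_lg n) (n := Nat.size n)
    (by linarith [size_le_lg_add_one n, one_le_lg n])
  linarith [one_le_lg (lg n)]

theorem size_le_self (n : ℕ) : Nat.size n ≤ n := Nat.size_le.2 Nat.lt_two_pow_self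

end Logarithms

/-! ### Choosing a scale and a set of buckets -/

section Plan

/-- The colors `x` of the list `L` with `2 ^ j ≤ b / (d x + 1) < 2 ^ (j + 1)`. -/
def bucket (b : ℕ) (L : Finset ℕ) (d : ℕ → ℕ) (j : ℕ) : Finset ℕ :=
  L.filter fun x => 2 ^ j * (d x + 1) ≤ b ∧ b < 2 ^ (j + 1) * (d x + 1)

/-- A scale `s` and a set `I` of buckets from which a node is ready to choose: every bucket in `I` is
large enough for the main run if at most a fraction `2 ^ (-s)` of the outneighbors chooses a close
bucket. If `s = 0`, this is no restriction; otherwise, `I` has to be large enough for the auxiliary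
run in class `s`. -/
structure IsPlan (h s₀ A Y b : ℕ) (L : Finset ℕ) (d : ℕ → ℕ) (s : ℕ) (I : Finset ℕ) : Prop where
  le : s ≤ s₀
  subset : I ⊆ range h
  nonempty : I.Nonempty
  scale_le : ∀ j ∈ I, s ≤ j
  card_bucket : ∀ j ∈ I, A * 4 ^ (j - s) ≤ (bucket b L d j).card
  card : s ≠ 0 → Y * 4 ^ s ≤ I.card

theorem sum_sq_le_sum_bucket {b h : ℕ} {L : Finset ℕ} {d : ℕ → ℕ}
    (hh : b < 2 ^ h) (hd : ∀ x ∈ L, d x < b) :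
    ∑ x ∈ L, ((d x : ℝ) + 1) ^ 2
      ≤ (b : ℝ) ^ 2 * ∑ j ∈ range h, ((bucket b L d j).card : ℝ) / 4 ^ j := by
  classical
  have hmem : ∀ x ∈ L, ∃ j ∈ range h, 2 ^ j * (d x + 1) ≤ b ∧ b < 2 ^ (j + 1) * (d x + 1) := by
    intro x hx
    have h1 : 0 < d x + 1 := Nat.succ_pos _
    have h2 : b / (d x + 1) ≠ 0 := (Nat.div_pos (hd x hx) h1).ne'
    have h3 := Nat.pow_log_le_self 2 h2
    have h4 := Nat.lt_pow_succ_log_self (b := 2) (by norm_num) (b / (d x + 1))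
    rw [Nat.le_div_iff_mul_le h1] at h3
    rw [Nat.div_lt_iff_lt_mul h1] at h4
    refine ⟨_, Finset.mem_range.2 ?_, h3, h4⟩
    have h5 : 2 ^ Nat.log 2 (b / (d x + 1)) < 2 ^ h :=
      lt_of_le_of_lt (le_trans (Nat.le_mul_of_pos_right _ h1) h3) hh
    exact (Nat.pow_lt_pow_iff_right (by norm_num)).1 h5
  calc ∑ x ∈ L, ((d x : ℝ) + 1) ^ 2
      ≤ ∑ x ∈ L, ∑ j ∈ range h,
          if 2 ^ j * (d x + 1) ≤ b ∧ b < 2 ^ (j + 1) * (d x + 1) then ((d x : ℝ) + 1) ^ 2 else 0 := by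
        refine Finset.sum_le_sum fun x hx => ?_
        obtain ⟨j, hj, hxj⟩ := hmem x hx
        refine le_trans (le_of_eq (if_pos hxj).symm)
          (Finset.single_le_sum (f := fun j => if 2 ^ j * (d x + 1) ≤ b ∧
            b < 2 ^ (j + 1) * (d x + 1) then ((d x : ℝ) + 1) ^ 2 else 0) (fun i _ => ?_) hj)
        split_ifs <;> positivity
    _ = ∑ j ∈ range h, ∑ x ∈ bucket b L d j, ((d x : ℝ) + 1) ^ 2 := by
        rw [Finset.sum_comm]
        refine Finset.sum_congr rfl fun j _ => ?_
        rw [bucket, Finset.sum_filter]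
    _ ≤ ∑ j ∈ range h, (b : ℝ) ^ 2 * (((bucket b L d j).card : ℝ) / 4 ^ j) := by
        refine Finset.sum_le_sum fun j _ => ?_
        calc ∑ x ∈ bucket b L d j, ((d x : ℝ) + 1) ^ 2
            ≤ ∑ x ∈ bucket b L d j, (b : ℝ) ^ 2 / 4 ^ j := by
              refine Finset.sum_le_sum fun x hx => ?_
              have h1 : 2 ^ j * (d x + 1) ≤ b := (Finset.mem_filter.1 hx).2.1
              have h2 : (2 : ℝ) ^ j * (d x + 1) ≤ b := by exact_mod_cast h1
              rw [le_div_iff₀ (by positivity)]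
              calc ((d x : ℝ) + 1) ^ 2 * 4 ^ j = (2 ^ j * (d x + 1)) ^ 2 := by
                    rw [show (4 : ℝ) = 2 ^ 2 by norm_num, ← pow_mul, mul_comm 2 j, pow_mul]
                    ring
                _ ≤ _ := by gcongr
          _ = _ := by
              rw [Finset.sum_const, nsmul_eq_mul]
              ring
    _ = _ := by rw [Finset.mul_sum]

/-- If there is no plan, then bucket `j` has fewer than `A * 4 ^ (j - s + 1)` colors for the least
scale `s` that is possible for it, and fewer than `Y * 4 ^ s` buckets have least scale `s`. Hence
every one of the scales `1, ..., s₀` contributes at most `4 * A * Y` to the weighted number of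
colors, and the buckets without any scale contribute at most `3 * A` altogether. -/
theorem exists_plan {h s₀ A Y b : ℕ} {L : Finset ℕ} {d : ℕ → ℕ} (hh : b < 2 ^ h)
    (hs₀ : h ≤ 4 ^ s₀) (hY : 0 < Y) (hd : ∀ x ∈ L, d x < b)
    (hsum : (b : ℝ) ^ 2 * (A * (3 + 4 * s₀ * Y)) < ∑ x ∈ L, ((d x : ℝ) + 1) ^ 2) :
    ∃ s I, IsPlan h s₀ A Y b L d s I := by
  classical
  by_contra! hno
  let Q : ℕ → ℕ → Prop := fun j s => s ≤ j ∧ A * 4 ^ (j - s) ≤ (bucket b L d j).card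
  have hplan : ∀ s ≤ s₀, ((range h).filter fun j => Q j s).Nonempty →
      s ≠ 0 ∧ ((range h).filter fun j => Q j s).card < Y * 4 ^ s := by
    intro s hs hne
    by_contra hcon
    refine hno s _ ⟨hs, Finset.filter_subset _ _, hne, fun j hj => (Finset.mem_filter.1 hj).2.1,
      fun j hj => (Finset.mem_filter.1 hj).2.2, fun h0 => ?_⟩
    by_contra hlt
    exact hcon ⟨h0, not_le.1 hlt⟩
  have hQ0 : ∀ j < h, ¬ Q j 0 := fun j hj hq =>
    (hplan 0 (Nat.zero_le _) ⟨j, by simp [hj, hq]⟩).1 rfl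
  have hcard : ∀ s ≤ s₀, (((range h).filter fun j => Q j s).card : ℝ) ≤ Y * 4 ^ s := by
    intro s hs
    rcases Finset.eq_empty_or_nonempty ((range h).filter fun j => Q j s) with he | hne
    · rw [he]; simp
    · exact_mod_cast (hplan s hs hne).2.le
  have hnot : ∀ j s, s ≤ j → ¬ Q j s → ((bucket b L d j).card : ℝ) / 4 ^ j ≤ A * (1 / 4 ^ s) := by
    intro j s hsj hq
    have h1 : (bucket b L d j).card < A * 4 ^ (j - s) := not_le.1 fun hle => hq ⟨hsj, hle⟩
    have h2 : ((bucket b L d j).card : ℝ) ≤ A * 4 ^ (j - s) := by exact_mod_cast h1.le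
    rw [div_le_iff₀ (by positivity)]
    refine h2.trans (le_of_eq ?_)
    rw [show (4 : ℝ) ^ j = 4 ^ (j - s) * 4 ^ s by rw [← pow_add, Nat.sub_add_cancel hsj]]
    field_simp
  have hpt : ∀ j ∈ range h, ((bucket b L d j).card : ℝ) / 4 ^ j
      ≤ A * ((1 / 4) ^ j + 1 / 4 ^ s₀) +
        ∑ s ∈ range (s₀ + 1), if s ≠ 0 ∧ Q j s then 4 * (A : ℝ) / 4 ^ s else 0 := by
    intro j hj
    have hnn : ∀ s ∈ range (s₀ + 1),
        0 ≤ if s ≠ 0 ∧ Q j s then 4 * (A : ℝ) / 4 ^ s else 0 := by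
      intro s _
      split_ifs <;> positivity
    by_cases hex : ∃ s, s ≤ s₀ ∧ Q j s
    · have hs := Nat.find_spec hex
      set s := Nat.find hex
      have hs0 : s ≠ 0 := fun h0 => hQ0 j (Finset.mem_range.1 hj) (h0 ▸ hs.2)
      have hprev : ¬ Q j (s - 1) := fun hq => Nat.find_min hex (m := s - 1)
        (by change s - 1 < s; omega) ⟨by omega, hq⟩
      have h1 := hnot j (s - 1) (by have := hs.2.1; omega) hprev
      have h2 : (A : ℝ) * (1 / 4 ^ (s - 1)) = 4 * A / 4 ^ s := by
        rw [show (4 : ℝ) ^ s = 4 ^ (s - 1) * 4 by rw [← pow_succ, Nat.sub_add_cancel (by omega)]]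
        field_simp
      have h3 := Finset.single_le_sum hnn (Finset.mem_range.2 (Nat.lt_succ_of_le hs.1))
      rw [if_pos ⟨hs0, hs.2⟩] at h3
      have : 0 ≤ (A : ℝ) * ((1 / 4) ^ j + 1 / 4 ^ s₀) := by positivity
      linarith
    · have h1 : ((bucket b L d j).card : ℝ) / 4 ^ j ≤ A * ((1 / 4) ^ j + 1 / 4 ^ s₀) := by
        rcases le_total j s₀ with hjs | hjs
        · refine (hnot j j le_rfl fun hq => hex ⟨j, hjs, hq⟩).trans ?_
          gcongr
          rw [one_div_pow]
          have : (0 : ℝ) ≤ 1 / 4 ^ s₀ := by positivity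
          linarith
        · refine (hnot j s₀ hjs fun hq => hex ⟨s₀, le_rfl, hq⟩).trans ?_
          gcongr
          have : (0 : ℝ) ≤ (1 / 4) ^ j := by positivity
          linarith
      linarith [Finset.sum_nonneg hnn]
  have hgeom : ∑ j ∈ range h, (1 / 4 : ℝ) ^ j ≤ 2 := by
    refine (Summable.sum_le_tsum _ (fun _ _ => by positivity)
      (summable_geometric_of_lt_one (by norm_num) (by norm_num))).trans ?_
    rw [tsum_geometric_of_lt_one (by norm_num) (by norm_num)]
    norm_num
  have hs₀' : (h : ℝ) * (1 / 4 ^ s₀) ≤ 1 := by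
    rw [mul_one_div, div_le_one (by positivity)]
    exact_mod_cast hs₀
  have htot : ∑ j ∈ range h, ((bucket b L d j).card : ℝ) / 4 ^ j ≤ A * (3 + 4 * s₀ * Y) := by
    refine (Finset.sum_le_sum hpt).trans ?_
    rw [Finset.sum_add_distrib, ← Finset.mul_sum, Finset.sum_add_distrib, Finset.sum_const,
      Finset.card_range, nsmul_eq_mul, Finset.sum_comm]
    have h1 : ∑ s ∈ range (s₀ + 1), ∑ j ∈ range h,
        (if s ≠ 0 ∧ Q j s then 4 * (A : ℝ) / 4 ^ s else 0) ≤ s₀ * (4 * A * Y) := by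
      rw [Finset.sum_range_succ']
      simp only [ne_eq, not_true_eq_false, false_and, if_false, Finset.sum_const_zero, add_zero]
      calc _ ≤ ∑ s ∈ range s₀, (4 * A * Y : ℝ) := by
            refine Finset.sum_le_sum fun s hs => ?_
            simp only [Nat.succ_ne_zero, not_false_eq_true, true_and]
            rw [← Finset.sum_filter, Finset.sum_const, nsmul_eq_mul]
            have := hcard (s + 1) (by have := Finset.mem_range.1 hs; omega)
            calc _ ≤ (Y * 4 ^ (s + 1) : ℝ) * (4 * A / 4 ^ (s + 1)) := by gcongr
              _ = _ := by field_simp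
        _ = _ := by simp
    have h2 : (A : ℝ) * (∑ j ∈ range h, (1 / 4 : ℝ) ^ j + h * (1 / 4 ^ s₀)) ≤ A * 3 := by
      gcongr
      linarith
    linarith
  have := sum_sq_le_sum_bucket hh hd
  have h3 : (b : ℝ) ^ 2 * ∑ j ∈ range h, ((bucket b L d j).card : ℝ) / 4 ^ j
      ≤ (b : ℝ) ^ 2 * (A * (3 + 4 * s₀ * Y)) := by gcongr
  linarith

end Plan

/-! ### The auxiliary and the main run -/

section TwoStages

/-- The number of buckets, which is also the number of classes of the main run. -/
def numBuckets (β : ℕ) : ℕ := Nat.log 2 β + 1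

/-- The largest scale. It satisfies `numBuckets β < 2 ^ maxScale β ≤ 2 * numBuckets β`. -/
def maxScale (β : ℕ) : ℕ := Nat.size (numBuckets β)

/-- The number of buckets in a window of close buckets. -/
def auxDegree (β : ℕ) : ℕ := 4 * maxScale β + 1

/-- The threshold `τ` of the auxiliary run. -/
def auxThreshold (m β : ℕ) : ℕ :=
  threshold (numBuckets β) m (maxScale β + 1) (auxDegree β)

/-- The threshold `τ` of the main run, for `n` colors. -/
def mainThreshold (n m β : ℕ) : ℕ := threshold n m (numBuckets β) 1

/-- Closeness of buckets. If the classes of two nodes in the main run differ by at most `maxScale β`,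
their buckets are close, since a class is a bucket minus a scale. -/
def Near (β x y : ℕ) : Prop := x ≤ y + 2 * maxScale β ∧ y ≤ x + 2 * maxScale β

/-- The core algorithm of the auxiliary run: the colors are the buckets, the classes are the scales. The
gap is irrelevant here. -/
noncomputable def auxCore (m β q : ℕ)
    (F : ℕ → ℕ → Finset ℕ → Fin (8 * 2 ^ (maxScale β + 1) * q) → Finset ℕ) : Core :=
  ⟨range (numBuckets β), m, maxScale β + 1, 0, auxThreshold m β, q, auxDegree β, Near β, F⟩

/-- The core algorithm of the main run, with equality as the relation. -/
def mainCore (C : Finset ℕ) (m β q : ℕ)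
    (F : ℕ → ℕ → Finset ℕ → Fin (8 * 2 ^ numBuckets β * q) → Finset ℕ) : Core :=
  ⟨C, m, numBuckets β, maxScale β, mainThreshold C.card m β, q, 1, Eq, F⟩

theorem exists_valid_auxCore (m β : ℕ) : ∃ q F, (auxCore m β q F).Valid := by
  classical
  obtain ⟨q, F, h⟩ := exists_valid_core (range (numBuckets β)) m (maxScale β + 1) 0 (auxDegree β)
    (Near β) (Nat.succ_pos _) (fun y => by
      rw [natCard_mem_and]
      calc _ ≤ (Finset.Icc (y - 2 * maxScale β) (y + 2 * maxScale β)).card := by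
            refine Finset.card_le_card fun x hx => ?_
            obtain ⟨-, h1, h2⟩ := Finset.mem_filter.1 hx
            rw [Finset.mem_Icc]
            omega
        _ ≤ _ := by rw [Nat.card_Icc, auxDegree]; omega)
  rw [Finset.card_range] at h
  exact ⟨q, F, h⟩

theorem exists_valid_mainCore (C : Finset ℕ) (m β : ℕ) : ∃ q F, (mainCore C m β q F).Valid :=
  exists_valid_core C m (numBuckets β) (maxScale β) 1 Eq one_pos (fun y => by
    classical
    rw [natCard_mem_and]
    refine Finset.card_le_one.2 fun a ha b hb => ?_
    rw [(Finset.mem_filter.1 ha).2, (Finset.mem_filter.1 hb).2])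

/-- The value `β_v`, computed by the node from its input. -/
noncomputable def nodeDeg (i : NodeInput) : ℕ := max 1 (outPorts i).card

/-- The colors whose defect cannot be exceeded. -/
noncomputable def freeColors (i : NodeInput) : Finset ℕ :=
  i.list.filter fun x => nodeDeg i ≤ i.defect x

/-- A plan with the parameters that the two runs require: `1024 * τ * 4 ^ c` and
`1024 * D * τ * 4 ^ c` are twice the respective `listSize`. -/
def NodePlan (n m β : ℕ) (i : NodeInput) (p : ℕ × Finset ℕ) : Prop :=
  IsPlan (numBuckets β) (maxScale β) (1024 * mainThreshold n m β)
    (1024 * auxDegree β * auxThreshold m β) (nodeDeg i) i.list i.defect p.1 p.2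

open Classical in
/-- The plan of a node. -/
noncomputable def nodePlan (n m β : ℕ) (i : NodeInput) : ℕ × Finset ℕ :=
  if h : ∃ p, NodePlan n m β i p then h.choose else (0, ∅)

theorem nodePlan_spec {n m β : ℕ} {i : NodeInput} (h : ∃ p, NodePlan n m β i p) :
    NodePlan n m β i (nodePlan n m β i) := by
  rw [nodePlan, dif_pos h]
  exact h.choose_spec

open Classical in
/-- The input of the auxiliary run. A node with scale `0` may choose any of its buckets; a node with free
colors does not need a bucket at all. -/
noncomputable def auxInput (n m β : ℕ) (i : NodeInput) : Msg :=
  ⟨i.color,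
    if (freeColors i).Nonempty ∨ (nodePlan n m β i).1 = 0 then maxScale β + 1
    else (nodePlan n m β i).1,
    if (freeColors i).Nonempty then {0} else (nodePlan n m β i).2⟩

open Classical in
/-- The input of the main run for a node that has chosen bucket `j`. -/
noncomputable def mainInput (n m β : ℕ) (i : NodeInput) (j : ℕ) : Msg :=
  if (freeColors i).Nonempty then ⟨i.color, numBuckets β, freeColors i⟩
  else ⟨i.color, j - (nodePlan n m β i).1, bucket (nodeDeg i) i.list i.defect j⟩

theorem numBuckets_le_threshold (n m β D : ℕ) :
    8 * numBuckets β + 64 ≤ threshold n m (numBuckets β) D := by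
  unfold threshold
  omega

theorem two_pow_maxScale_le (β : ℕ) : 2 ^ maxScale β ≤ 2 * numBuckets β := by
  have h : 0 < maxScale β := Nat.size_pos.2 (Nat.succ_pos _)
  have h1 : 2 ^ (maxScale β - 1) ≤ numBuckets β := by
    rw [← Nat.lt_size]
    change maxScale β - 1 < maxScale β
    omega
  calc 2 ^ maxScale β = 2 * 2 ^ (maxScale β - 1) := by
        rw [← pow_succ', Nat.sub_add_cancel h]
    _ ≤ _ := by omega

variable {V : Type*} [Fintype V] {C : Finset ℕ} {m β : ℕ} (N : Network V C m)

theorem nodeDeg_input (v : V) : nodeDeg (N.input v) = outDeg N.graph v := by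
  rw [nodeDeg, card_outPorts, outDeg]

theorem card_outNbrs_le (v : V) : (outNbrs N.graph v).card ≤ nodeDeg (N.input v) := by
  rw [nodeDeg_input]
  exact le_max_right _ _

theorem admissible_auxInput (q F)
    (hplan : ∀ v, (freeColors (N.input v)).Nonempty ∨ ∃ p, NodePlan C.card m β (N.input v) p) :
    (auxCore m β q F).Admissible N.graph fun v => auxInput C.card m β (N.input v) where
  proper u v h heq := N.color_proper u v h (Fin.ext heq)
  color_lt v := (N.color v).2
  list_subset v := by
    change (auxInput C.card m β (N.input v)).set ⊆ range (numBuckets β)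
    unfold auxInput
    dsimp only
    split_ifs with hf
    · simp [numBuckets]
    · exact (nodePlan_spec ((hplan v).resolve_left hf)).subset
  list_card v hv := by
    change (auxInput C.card m β (N.input v)).cls < maxScale β + 1 at hv
    change 2 * listSize (auxDegree β) (auxThreshold m β) (auxInput C.card m β (N.input v)).cls ≤ _
    unfold auxInput at hv ⊢
    dsimp only at hv ⊢
    by_cases h : (freeColors (N.input v)).Nonempty ∨ (nodePlan C.card m β (N.input v)).1 = 0
    · rw [if_pos h] at hv
      omega
    · rw [if_neg h]
      push Not at h
      rw [if_neg (Finset.not_nonempty_iff_eq_empty.2 h.1)]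
      refine le_trans (le_of_eq ?_) ((nodePlan_spec ((hplan v).resolve_left
        (Finset.not_nonempty_iff_eq_empty.2 h.1))).card h.2)
      unfold listSize setSize blockSize
      rw [show (4 : ℕ) = 2 * 2 from rfl, mul_pow]
      ring
  nonempty v := by
    unfold auxInput
    dsimp only
    split_ifs with hf
    · exact Finset.singleton_nonempty _
    · exact (nodePlan_spec ((hplan v).resolve_left hf)).nonempty

theorem auxInput_cls_le (v : V)
    (hplan : ∀ v, (freeColors (N.input v)).Nonempty ∨ ∃ p, NodePlan C.card m β (N.input v) p) :
    (auxInput C.card m β (N.input v)).cls ≤ maxScale β + 1 := by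
  unfold auxInput
  dsimp only
  split_ifs with h
  · exact le_rfl
  · exact (nodePlan_spec ((hplan v).resolve_left (not_or.1 h).1)).le.trans (Nat.le_succ _)

theorem result_auxCore_mem {q F} (hV : (auxCore m β q F).Valid)
    (hplan : ∀ v, (freeColors (N.input v)).Nonempty ∨ ∃ p, NodePlan C.card m β (N.input v) p)
    {v : V} (hv : ¬ (freeColors (N.input v)).Nonempty) :
    (auxCore m β q F).result N.graph (fun v => auxInput C.card m β (N.input v)) v
      ∈ (nodePlan C.card m β (N.input v)).2 := by
  have h := Core.result_mem hV (admissible_auxInput N q F hplan) v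
  simpa only [auxInput, if_neg hv] using h

open Classical in
/-- After the auxiliary run, at most a fraction `2 ^ (-s)` of the outneighbors has chosen a bucket close
to that of `v`, where `s` is the scale of `v`. -/
theorem card_near_le {q F} (hV : (auxCore m β q F).Valid)
    (hplan : ∀ v, (freeColors (N.input v)).Nonempty ∨ ∃ p, NodePlan C.card m β (N.input v) p)
    {v : V} (hv : ¬ (freeColors (N.input v)).Nonempty) :
    (2 : ℝ) ^ (nodePlan C.card m β (N.input v)).1 *
      ((outNbrs N.graph v).filter fun u => Near β
        ((auxCore m β q F).result N.graph (fun v => auxInput C.card m β (N.input v)) v)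
        ((auxCore m β q F).result N.graph (fun v => auxInput C.card m β (N.input v)) u)).card
      ≤ (outNbrs N.graph v).card := by
  set s := (nodePlan C.card m β (N.input v)).1 with hs
  by_cases h0 : s = 0
  · rw [h0, pow_zero, one_mul]
    exact_mod_cast Finset.card_filter_le _ _
  have hcls : (auxInput C.card m β (N.input v)).cls = s := by
    unfold auxInput
    exact if_neg (not_or.2 ⟨hv, h0⟩)
  have hle : s ≤ maxScale β := (nodePlan_spec ((hplan v).resolve_left hv)).le
  have h := Core.card_related_result_le hV (admissible_auxInput N q F hplan) (v := v)
    (by rw [hcls]; exact Nat.lt_succ_of_le hle)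
  rw [hcls] at h
  refine h.trans ?_
  change _ + _ / (64 * 2 ^ 0) + _ * ((auxDegree β : ℕ) : ℝ) / (8 * ((auxThreshold m β : ℕ) : ℝ)) ≤ _
  have h1 : (((outNbrs N.graph v).filter fun u => (auxInput C.card m β (N.input u)).cls ≤ s ∧
      s ≤ (auxInput C.card m β (N.input u)).cls + (auxCore m β q F).g).card : ℝ)
      ≤ (outNbrs N.graph v).card := by exact_mod_cast Finset.card_filter_le _ _
  have hD : auxDegree β ≤ auxThreshold m β := by
    unfold auxThreshold threshold auxDegree
    omega
  have hD0 : (0 : ℝ) < auxThreshold m β := by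
    have : 0 < auxThreshold m β := lt_of_lt_of_le (Nat.succ_pos _) hD
    exact_mod_cast this
  have h2 : ((outNbrs N.graph v).card : ℝ) * auxDegree β / (8 * auxThreshold m β)
      ≤ (outNbrs N.graph v).card / 8 := by
    have hD' : (auxDegree β : ℝ) ≤ auxThreshold m β := by exact_mod_cast hD
    rw [div_le_div_iff₀ (by positivity) (by norm_num)]
    nlinarith [mul_le_mul_of_nonneg_left hD' (Nat.cast_nonneg (α := ℝ) (outNbrs N.graph v).card)]
  have h3 : (0 : ℝ) ≤ (outNbrs N.graph v).card := Nat.cast_nonneg _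
  rw [pow_zero, mul_one]
  linarith

variable (j : V → ℕ)

theorem mainInput_of_not {v : V} (hv : ¬ (freeColors (N.input v)).Nonempty) :
    mainInput C.card m β (N.input v) (j v) = ⟨N.color v, j v - (nodePlan C.card m β (N.input v)).1,
      bucket (nodeDeg (N.input v)) (N.list v) (N.defect v) (j v)⟩ := by
  rw [mainInput, if_neg hv]
  rfl

theorem mainInput_of_free {v : V} (hv : (freeColors (N.input v)).Nonempty) :
    mainInput C.card m β (N.input v) (j v) =
      ⟨N.color v, numBuckets β, freeColors (N.input v)⟩ := by
  rw [mainInput, if_pos hv]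
  rfl

theorem mainInput_set_subset (v : V) :
    (mainInput C.card m β (N.input v) (j v)).set ⊆ N.list v := by
  by_cases hf : (freeColors (N.input v)).Nonempty
  · rw [mainInput_of_free N j hf]
    exact Finset.filter_subset _ _
  · rw [mainInput_of_not N j hf]
    exact Finset.filter_subset _ _

theorem mainInput_color (v : V) :
    (mainInput C.card m β (N.input v) (j v)).color = N.color v := by
  by_cases hf : (freeColors (N.input v)).Nonempty
  · rw [mainInput_of_free N j hf]
  · rw [mainInput_of_not N j hf]

theorem admissible_mainInput (q F)
    (hplan : ∀ v, (freeColors (N.input v)).Nonempty ∨ ∃ p, NodePlan C.card m β (N.input v) p)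
    (hj : ∀ v, ¬ (freeColors (N.input v)).Nonempty → j v ∈ (nodePlan C.card m β (N.input v)).2) :
    (mainCore C m β q F).Admissible N.graph
      fun v => mainInput C.card m β (N.input v) (j v) := by
  have hpos : 0 < mainThreshold C.card m β :=
    lt_of_lt_of_le (by omega) (numBuckets_le_threshold C.card m β 1)
  have hb : ∀ v, ¬ (freeColors (N.input v)).Nonempty →
      2 * listSize 1 (mainThreshold C.card m β) (j v - (nodePlan C.card m β (N.input v)).1) ≤
        (bucket (nodeDeg (N.input v)) (N.list v) (N.defect v) (j v)).card := by
    intro v hv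
    refine le_trans (le_of_eq ?_)
      ((nodePlan_spec ((hplan v).resolve_left hv)).card_bucket _ (hj v hv))
    unfold listSize setSize blockSize
    rw [show (4 : ℕ) = 2 * 2 from rfl, mul_pow]
    ring
  refine ⟨fun u v h heq => ?_, fun v => ?_, fun v => ?_, fun v hv => ?_, fun v => ?_⟩
  · rw [mainInput_color, mainInput_color] at heq
    exact N.color_proper u v h (Fin.ext heq)
  · rw [mainInput_color]
    exact (N.color v).2
  · exact (mainInput_set_subset N j v).trans (N.list_subset v)
  · by_cases hf : (freeColors (N.input v)).Nonempty
    · rw [mainInput_of_free N j hf] at hv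
      exact absurd hv (lt_irrefl _)
    · rw [mainInput_of_not N j hf]
      exact hb v hf
  · by_cases hf : (freeColors (N.input v)).Nonempty
    · rw [mainInput_of_free N j hf]
      exact hf
    · rw [mainInput_of_not N j hf]
      refine Finset.card_pos.1 (lt_of_lt_of_le ?_ (hb v hf))
      unfold listSize setSize blockSize
      positivity

theorem mainInput_cls_le (v : V)
    (hplan : ∀ v, (freeColors (N.input v)).Nonempty ∨ ∃ p, NodePlan C.card m β (N.input v) p)
    (hj : ∀ v, ¬ (freeColors (N.input v)).Nonempty → j v ∈ (nodePlan C.card m β (N.input v)).2) :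
    (mainInput C.card m β (N.input v) (j v)).cls ≤ numBuckets β := by
  by_cases hf : (freeColors (N.input v)).Nonempty
  · rw [mainInput_of_free N j hf]
  · rw [mainInput_of_not N j hf]
    have := Finset.mem_range.1
      ((nodePlan_spec ((hplan v).resolve_left hf)).subset (hj v hf))
    change j v - _ ≤ _
    omega

open Classical in
/-- If few outneighbors choose a close bucket, then the main run solves the instance. -/
theorem isOrientedListDefectiveColoring_result {q F} (hV : (mainCore C m β q F).Valid)
    (hplan : ∀ v, (freeColors (N.input v)).Nonempty ∨ ∃ p, NodePlan C.card m β (N.input v) p)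
    (hj : ∀ v, ¬ (freeColors (N.input v)).Nonempty → j v ∈ (nodePlan C.card m β (N.input v)).2)
    (hnear : ∀ v, ¬ (freeColors (N.input v)).Nonempty →
      (2 : ℝ) ^ (nodePlan C.card m β (N.input v)).1 *
        ((outNbrs N.graph v).filter fun u => Near β (j v) (j u)).card
        ≤ (outNbrs N.graph v).card) :
    IsOrientedListDefectiveColoring N.graph N.list N.defect
      ((mainCore C m β q F).result N.graph
        fun v => mainInput C.card m β (N.input v) (j v)) := by
  have hA := admissible_mainInput N j q F hplan hj
  set φ := (mainCore C m β q F).result N.graph fun v => mainInput C.card m β (N.input v) (j v)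
  intro v
  have hmem : φ v ∈ (mainInput C.card m β (N.input v) (j v)).set := Core.result_mem hV hA v
  refine ⟨mainInput_set_subset N j v hmem, ?_⟩
  by_cases hf : (freeColors (N.input v)).Nonempty
  · rw [mainInput_of_free N j hf] at hmem
    have h1 : nodeDeg (N.input v) ≤ N.defect v (φ v) := (Finset.mem_filter.1 hmem).2
    exact (Finset.card_filter_le _ _).trans ((card_outNbrs_le N v).trans h1)
  have hp := nodePlan_spec ((hplan v).resolve_left hf)
  set s := (nodePlan C.card m β (N.input v)).1 with hs
  have hsj : s ≤ j v := hp.scale_le _ (hj v hf)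
  have hjv : j v < numBuckets β := Finset.mem_range.1 (hp.subset (hj v hf))
  have hcls : (mainInput C.card m β (N.input v) (j v)).cls = j v - s := by
    rw [mainInput_of_not N j hf]
  have h := Core.card_related_result_le hV hA (v := v) (by
    rw [hcls]; exact lt_of_le_of_lt (Nat.sub_le _ _) hjv)
  rw [hcls] at h
  rw [mainInput_of_not N j hf] at hmem
  obtain ⟨-, -, hlt⟩ := Finset.mem_filter.1 hmem
  change (2 : ℝ) ^ (j v - s) * ((outNbrs N.graph v).filter fun u =>
      (mainCore C m β q F).R (φ v) (φ u)).card ≤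
    ((outNbrs N.graph v).filter fun u =>
      (mainInput C.card m β (N.input u) (j u)).cls ≤ j v - s ∧
        j v - s ≤ (mainInput C.card m β (N.input u) (j u)).cls + maxScale β).card / 4 +
    (outNbrs N.graph v).card / (64 * 2 ^ maxScale β) +
    (outNbrs N.graph v).card * ((1 : ℕ) : ℝ) / (8 * (mainThreshold C.card m β : ℕ)) at h
  have hM : ((outNbrs N.graph v).filter fun u =>
      (mainInput C.card m β (N.input u) (j u)).cls ≤ j v - s ∧
        j v - s ≤ (mainInput C.card m β (N.input u) (j u)).cls + maxScale β).card ≤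
      ((outNbrs N.graph v).filter fun u => Near β (j v) (j u)).card := by
    refine Finset.card_le_card fun u hu => ?_
    obtain ⟨huo, h1, h2⟩ := Finset.mem_filter.1 hu
    refine Finset.mem_filter.2 ⟨huo, ?_⟩
    by_cases hfu : (freeColors (N.input u)).Nonempty
    · rw [mainInput_of_free N j hfu] at h1
      dsimp only at h1
      omega
    · rw [mainInput_of_not N j hfu] at h1 h2
      dsimp only at h1 h2
      have hpu := nodePlan_spec ((hplan u).resolve_left hfu)
      have h3 := hpu.le
      have h4 := hpu.scale_le _ (hj u hfu)
      have h5 := hp.le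
      unfold Near
      omega
  set M := ((outNbrs N.graph v).filter fun u =>
      (mainInput C.card m β (N.input u) (j u)).cls ≤ j v - s ∧
        j v - s ≤ (mainInput C.card m β (N.input u) (j u)).cls + maxScale β).card
  have hM' : (2 : ℝ) ^ s * M ≤ (outNbrs N.graph v).card := by
    refine le_trans ?_ (hnear v hf)
    gcongr
  have hset : ((outNbrs N.graph v).filter fun u => (mainCore C m β q F).R (φ v) (φ u))
      = (outNbrs N.graph v).filter fun u => φ u = φ v :=
    Finset.filter_congr fun u _ => ⟨Eq.symm, Eq.symm⟩
  rw [hset] at h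
  set k := ((outNbrs N.graph v).filter fun u => φ u = φ v).card with hk
  set o := (outNbrs N.graph v).card with ho
  have ho1 : (o : ℝ) ≤ nodeDeg (N.input v) := by exact_mod_cast card_outNbrs_le N v
  have hb1 : (1 : ℝ) ≤ nodeDeg (N.input v) := by exact_mod_cast le_max_left _ _
  have hs1 : (2 : ℝ) ^ s ≤ 2 ^ maxScale β := pow_le_pow_right₀ (by norm_num) hp.le
  have hs2 : (2 : ℝ) ^ s ≤ mainThreshold C.card m β := by
    refine hs1.trans ?_
    have := (two_pow_maxScale_le β).trans (show 2 * numBuckets β ≤ mainThreshold C.card m β by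
      have := numBuckets_le_threshold C.card m β 1
      unfold mainThreshold
      omega)
    exact_mod_cast this
  have hpos : (0 : ℝ) < mainThreshold C.card m β := lt_of_lt_of_le (by positivity) hs2
  have ho0 : (0 : ℝ) ≤ o := Nat.cast_nonneg _
  have h1 : (2 : ℝ) ^ s * (o / (64 * 2 ^ maxScale β)) ≤ o / 64 := by
    rw [← mul_div_assoc, div_le_div_iff₀ (by positivity) (by norm_num)]
    nlinarith [mul_le_mul_of_nonneg_left hs1 ho0]
  have h2 : (2 : ℝ) ^ s * (o * ((1 : ℕ) : ℝ) / (8 * (mainThreshold C.card m β : ℕ))) ≤ o / 8 := by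
    rw [← mul_div_assoc, div_le_div_iff₀ (by positivity) (by norm_num)]
    push_cast
    nlinarith [mul_le_mul_of_nonneg_left hs2 ho0]
  have h3 : (2 : ℝ) ^ (j v) * k ≤ o / 4 + o / 64 + o / 8 := by
    calc (2 : ℝ) ^ (j v) * k = 2 ^ s * (2 ^ (j v - s) * k) := by
          rw [← mul_assoc, ← pow_add, Nat.add_sub_cancel' hsj]
      _ ≤ 2 ^ s * _ := mul_le_mul_of_nonneg_left h (by positivity)
      _ = (2 ^ s * M) / 4 + 2 ^ s * (o / (64 * 2 ^ maxScale β)) +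
            2 ^ s * (o * ((1 : ℕ) : ℝ) / (8 * (mainThreshold C.card m β : ℕ))) := by ring
      _ ≤ _ := by linarith
  -- The total fraction `1 / 4 + 1 / 64 + 1 / 8` is less than `1 / 2`.
  have h4 : (2 : ℝ) ^ (j v + 1) * k < 2 ^ (j v + 1) * (N.defect v (φ v) + 1) := by
    have hlt' : (nodeDeg (N.input v) : ℝ) < 2 ^ (j v + 1) * (N.defect v (φ v) + 1) := by
      exact_mod_cast hlt
    refine lt_of_le_of_lt ?_ hlt'
    rw [pow_succ]
    linarith
  have h5 : (k : ℝ) < N.defect v (φ v) + 1 := lt_of_mul_lt_mul_left h4 (by positivity)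
  have h6 : k < N.defect v (φ v) + 1 := by exact_mod_cast h5
  have h7 : k ≤ N.defect v (φ v) := by omega
  rw [hk] at h7
  convert h7

end TwoStages

/-! ### Numerical bounds -/

section Bounds

theorem numBuckets_le (β : ℕ) : (numBuckets β : ℝ) ≤ 2 * lg β := by
  have := natLog_le_lg β
  have := one_le_lg β
  unfold numBuckets
  push_cast
  linarith

theorem maxScale_le (β : ℕ) : (maxScale β : ℝ) ≤ 3 * lg (lg β) := by
  have := size_le_lg_of_le (one_le_lg β) (numBuckets_le β)
  unfold maxScale
  linarith [one_le_lg (lg β)]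

theorem mainThreshold_le (n m β : ℕ) :
    (mainThreshold n m β : ℝ) ≤ 48 * (lg β + lg (lg n) + lg (lg m)) := by
  have h1 := numBuckets_le β
  have h2 := size_size_le m
  have h3 := size_size_le n
  have := one_le_lg β
  have := one_le_lg (lg n)
  have := one_le_lg (lg m)
  unfold mainThreshold threshold
  rw [Nat.size_one]
  push_cast
  linarith

theorem auxThreshold_le (m β : ℕ) :
    (auxThreshold m β : ℝ) ≤ 224 * (lg (lg β) + lg (lg m)) := by
  have h1 := maxScale_le β
  have h2 := size_size_le m
  have h3 : (Nat.size (Nat.size (numBuckets β)) : ℝ) ≤ maxScale β := by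
    exact_mod_cast size_le_self (maxScale β)
  have h4 : (Nat.size (auxDegree β) : ℝ) ≤ 4 * maxScale β + 1 := by
    exact_mod_cast size_le_self (auxDegree β)
  have := one_le_lg (lg β)
  have := one_le_lg (lg m)
  unfold auxThreshold threshold
  push_cast
  linarith

/-- The bound that `exists_plan` requires is of the order of `κ`. -/
theorem plan_bound_lt (n m β : ℕ) :
    ((1024 * mainThreshold n m β : ℕ) : ℝ) * (3 + 4 * maxScale β *
      (1024 * auxDegree β * auxThreshold m β : ℕ)) < 10 ^ 13 * kappa β n m := by
  have h1 := mainThreshold_le n m β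
  have h2 := auxThreshold_le m β
  have h3 := maxScale_le β
  have ha := one_le_lg (lg β)
  have hb := one_le_lg (lg m)
  have hl := one_le_lg β
  have hc := one_le_lg (lg n)
  unfold kappa
  set a := lg (lg β)
  set F₁ := lg β + lg (lg n) + lg (lg m)
  set F₂ := a + lg (lg m)
  have hF₁ : 0 < F₁ := by positivity
  have hF₂ : 1 ≤ F₂ := by linarith
  have hD : (auxDegree β : ℝ) ≤ 13 * a := by
    unfold auxDegree
    push_cast
    linarith
  have hK : 1 ≤ F₂ * a ^ 2 := by nlinarith [sq_nonneg (a - 1)]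
  push_cast
  have hin : 3 + 4 * (maxScale β : ℝ) * (1024 * auxDegree β * auxThreshold m β)
      ≤ 35782660 * (F₂ * a ^ 2) := by
    calc 3 + 4 * (maxScale β : ℝ) * (1024 * auxDegree β * auxThreshold m β)
        ≤ 3 + 4 * (3 * a) * (1024 * (13 * a) * (224 * F₂)) := by gcongr
      _ = 3 + 35782656 * (F₂ * a ^ 2) := by ring
      _ ≤ _ := by linarith
  calc 1024 * (mainThreshold n m β : ℝ) *
        (3 + 4 * (maxScale β : ℝ) * (1024 * auxDegree β * auxThreshold m β))
      ≤ 1024 * (48 * F₁) * (35782660 * (F₂ * a ^ 2)) := by gcongr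
    _ = 1758789304320 * (F₁ * F₂ * a ^ 2) := by ring
    _ < 10 ^ 13 * (F₁ * F₂ * a ^ 2) := by
        have : 0 < F₁ * F₂ * a ^ 2 := by positivity
        linarith

end Bounds

/-! ### The complete algorithm -/

section Assembly

/-- The auxiliary run `P₁`, followed by the main run `P₂` with the bucket selected in the first. -/
noncomputable def twoStageRule (C : Finset ℕ) (m β : ℕ) (P₁ P₂ : Core) : Rule NodeInput Msg :=
  P₁.rule.seq (3 * P₁.H + 1) P₂.rule (auxInput C.card m β)
    fun i w => mainInput C.card m β i (P₁.output w)

theorem exists_nodePlan {V : Type*} [Fintype V] {C : Finset ℕ} {m : ℕ} (N : Network V C m)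
    {v : V} (h : (10 : ℝ) ^ 13 * (outDeg N.graph v : ℝ) ^ 2 *
        kappa (maxOutDeg N.graph) C.card m ≤ ∑ x ∈ N.list v, ((N.defect v x : ℝ) + 1) ^ 2) :
    (freeColors (N.input v)).Nonempty ∨
      ∃ p, NodePlan C.card m (maxOutDeg N.graph) (N.input v) p := by
  set β := maxOutDeg N.graph
  refine or_iff_not_imp_left.2 fun hf => ?_
  have hd : ∀ x ∈ N.list v, N.defect v x < nodeDeg (N.input v) := by
    intro x hx
    by_contra! hle
    exact hf ⟨x, Finset.mem_filter.2 ⟨hx, hle⟩⟩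
  have hβ : nodeDeg (N.input v) ≤ β := by
    rw [nodeDeg_input]
    exact Finset.le_sup (f := outDeg N.graph) (Finset.mem_univ v)
  have hpos : (0 : ℝ) < nodeDeg (N.input v) := by
    have : 0 < nodeDeg (N.input v) := lt_of_lt_of_le one_pos (le_max_left _ _)
    exact_mod_cast this
  obtain ⟨s, I, hp⟩ := exists_plan (h := numBuckets β) (s₀ := maxScale β)
    (A := 1024 * mainThreshold C.card m β) (Y := 1024 * auxDegree β * auxThreshold m β)
    (lt_of_le_of_lt hβ (Nat.lt_pow_succ_log_self (by norm_num) β))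
    (((Nat.lt_size_self _).le).trans (Nat.pow_le_pow_left (by norm_num) _))
    (by
      have : 0 < auxThreshold m β := by unfold auxThreshold threshold; omega
      unfold auxDegree
      positivity) hd (lt_of_lt_of_le (by
        rw [← nodeDeg_input, mul_comm ((10 : ℝ) ^ 13), mul_assoc] at h
        refine lt_of_lt_of_le ?_ h
        exact mul_lt_mul_of_pos_left (plan_bound_lt _ _ _) (by positivity)) le_rfl)
  exact ⟨(s, I), hp⟩

end Assembly

end OLDC

theorem theorem1 :
    ∃ α c : ℝ, 0 < α ∧ 0 < c ∧
      -- the algorithm may depend on the color space, on `m` and on `β` only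
      ∀ (C : Finset ℕ) (m β : ℕ), ∃ (A : OLDC.Algorithm) (T : ℕ),
        (T : ℝ) ≤ c * OLDC.lg β ∧
        ∀ (V : Type*) [Fintype V] (N : OLDC.Network V C m),
          OLDC.maxOutDeg N.graph = β →
          (∀ v : V, α * (OLDC.outDeg N.graph v : ℝ) ^ 2 * OLDC.kappa β C.card m
            ≤ ∑ x ∈ N.list v, ((N.defect v x : ℝ) + 1) ^ 2) →
          A.SolvesWithin N T ∧
          A.UsesMessagesOfSize N
            (c * (min (C.card : ℝ) (N.maxListSize * OLDC.lg C.card) + OLDC.lg β + OLDC.lg m)) := by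
  open OLDC in
  refine ⟨10 ^ 13, 20, by norm_num, by norm_num, fun C m β => ?_⟩
  obtain ⟨q₁, F₁, hV₁⟩ := exists_valid_auxCore m β
  obtain ⟨q₂, F₂, hV₂⟩ := exists_valid_mainCore C m β
  obtain ⟨e₁, he₁, hs₁⟩ := exists_encoding (Finset.range (numBuckets β)) m (maxScale β + 1)
  obtain ⟨e₂, he₂, hs₂⟩ := exists_encoding C m (numBuckets β)
  set P₁ := auxCore m β q₁ F₁ with hP₁
  set P₂ := mainCore C m β q₂ F₂ with hP₂
  set T₁ := 3 * P₁.H + 1 with hT₁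
  let enc : ℕ → Msg → ℕ := fun t => if t < T₁ then e₁ else e₂
  have henc : ∀ t, Function.Injective (enc t) := fun t => by
    simp only [enc]
    split_ifs
    exacts [he₁, he₂]
  have hscale : maxScale β ≤ numBuckets β := size_le_self _
  refine ⟨(twoStageRule C m β P₁ P₂).toAlgorithm enc (T₁ + (3 * P₂.H + 1))
    fun _ w => P₂.output fun s => w (T₁ + s), T₁ + (3 * P₂.H + 1), ?_, ?_⟩
  · have h1 : T₁ + (3 * P₂.H + 1) ≤ 6 * numBuckets β + 5 := by
      change 3 * (maxScale β + 1) + 1 + (3 * numBuckets β + 1) ≤ _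
      omega
    have h2 : ((T₁ + (3 * P₂.H + 1) : ℕ) : ℝ) ≤ 6 * numBuckets β + 5 := by exact_mod_cast h1
    linarith [numBuckets_le β, one_le_lg β]
  intro V _ N hβ hsum
  subst hβ
  have hplan := fun v => exists_nodePlan N (hsum v)
  set β := maxOutDeg N.graph
  set j : V → ℕ := P₁.result N.graph fun v => auxInput C.card m β (N.input v) with hj
  have hjmem := fun v (hv : ¬ (freeColors (N.input v)).Nonempty) =>
    result_auxCore_mem N hV₁ hplan hv
  have hnear := fun v (hv : ¬ (freeColors (N.input v)).Nonempty) => card_near_le N hV₁ hplan hv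
  have hsol := isOrientedListDefectiveColoring_result N j hV₂ hplan hjmem hnear
  refine ⟨⟨_, fun v => ?_, hsol⟩, ?_⟩
  · rw [toAlgorithm_output N _ enc henc]
    exact congrArg some (congrArg P₂.output (hist_seq_add N.graph T₁ P₁.rule P₂.rule _ _ N.input _ v))
  · have hm := size_le_lg_add_one m
    have hn := size_le_lg_add_one C.card
    have hl := one_le_lg β
    have hlm := one_le_lg m
    have hln := one_le_lg C.card
    have hh := numBuckets_le β
    have hmin0 : 0 ≤ min (C.card : ℝ) (N.maxListSize * lg C.card) :=
      le_min (by positivity) (by positivity)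
    refine toAlgorithm_messages N _ enc henc _ _ _ (by positivity) fun t ht v => ?_
    by_cases h1 : t < T₁
    · have hA := admissible_auxInput N q₁ F₁ hplan
      have hmsg : msg N.graph (twoStageRule C m β P₁ P₂) N.input t v = _ :=
        msg_seq_of_lt N.graph T₁ P₁.rule P₂.rule _ _ N.input h1 v
      simp only [enc, if_pos h1]
      rw [hmsg]
      have h2 := hs₁ (msg N.graph P₁.rule (fun v => auxInput C.card m β (N.input v)) t v)
        (hA.color_lt v) (auxInput_cls_le N v hplan)
        ((P₁.msg_set_subset _ _ _ _).trans (hA.list_subset v))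
      have h3 : Nat.size (maxScale β + 1 + 1) ≤ numBuckets β + 2 :=
        (size_le_self _).trans (by omega)
      have h4 := h2.trans (Nat.add_le_add (Nat.add_le_add_left h3 _) (min_le_left _ _))
      rw [Finset.card_range] at h4
      have h5 := (Nat.cast_le (α := ℝ)).2 h4
      push_cast at h5
      linarith
    · obtain ⟨t', rfl⟩ := Nat.exists_eq_add_of_le (not_lt.1 h1)
      have hA := admissible_mainInput N j q₂ F₂ hplan hjmem
      have hmsg : msg N.graph (twoStageRule C m β P₁ P₂) N.input (T₁ + t') v = msg N.graph P₂.rule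
          (fun v => mainInput C.card m β (N.input v) (j v)) t' v :=
        msg_seq_add N.graph T₁ P₁.rule P₂.rule _ _ N.input t' v
      simp only [enc, if_neg h1]
      rw [hmsg]
      set x := msg N.graph P₂.rule (fun v => mainInput C.card m β (N.input v) (j v)) t' v
      have hsub : x.set ⊆ N.list v :=
        (P₂.msg_set_subset _ _ _ _).trans (mainInput_set_subset N j v)
      have h2 := hs₂ x (hA.color_lt v) (mainInput_cls_le N j v hplan hjmem)
        (hsub.trans (N.list_subset v))
      have h3 : Nat.size (numBuckets β + 1) ≤ numBuckets β + 1 := size_le_self _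
      have h4 : x.set.card ≤ N.maxListSize := (Finset.card_le_card hsub).trans
        (Finset.le_sup (f := fun v => (N.list v).card) (Finset.mem_univ v))
      have h5 : ((min C.card (x.set.card * Nat.size C.card) : ℕ) : ℝ)
          ≤ 2 * min (C.card : ℝ) (N.maxListSize * lg C.card) := by
        push_cast
        rw [mul_min_of_nonneg _ _ (by norm_num)]
        refine min_le_min (by linarith [Nat.cast_nonneg (α := ℝ) C.card]) ?_
        calc (x.set.card : ℝ) * Nat.size C.card ≤ N.maxListSize * (2 * lg C.card) := by
              gcongr
              linarith
          _ = _ := by ring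
      have h6 := (Nat.cast_le (α := ℝ)).2
        (h2.trans (Nat.add_le_add_right (Nat.add_le_add_left h3 _) _))
      rw [Nat.cast_add] at h6
      push_cast at h6 h5
      linarith
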